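/- Let $\mathbb R_3$ be the real Clifford algebra generated by $e_1,e_2,e_3$ with $e_j^2=-1$ and $e_ie_j=-e_je_i$ for $i\ne j$; write $e_{12}=e_1e_2$, and let $\lambda\mapsto\bar\lambda$ be the real-linear anti-automorphism of $\mathbb R_3$ with $\bar e_j=-e_j$. Let $\partial_x=\sum_{j=1}^3 e_j\,\partial_{x_j}$ be the Dirac operator on $\mathbb R^3$. For $d\ge 0$ let $\mathcal M_\ell^+(d)$ be the right $\mathbb R_3$-module of all $\mathbb R_3$-valued homogeneous polynomials $f$ of degree $d$ on $\mathbb R^3$ (together with $0$) with $\partial_x f=0$. For $x=(r\cos\theta\sin\phi,\,r\sin\theta\sin\phi,\,r\cos\phi)$ with $r\ge0$, $0\le\phi\le\pi$, and $k\ge 1$, put $$H_k^0(x)=\frac{r^k}{\sqrt{8\pi}}P_k^{(0,0)}(\cos\phi),\qquad H_k^1(x)=0,$$ $$H_k^{2n}(x)=\frac{r^k}{2^{n+1}\sqrt\pi}(\sin\phi)^nP_{k-n}^{(n,n)}(\cos\phi)\cos n\theta,\qquad H_k^{2n+1}(x)=\frac{r^k}{2^{n+1}\sqrt\pi}(\sin\phi)^nP_{k-n}^{(n,n)}(\cos\phi)\sin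 n\theta\qquad(1\le n\le k),$$ where $P_m^{(\alpha,\beta)}(t)=2^{-m}\sum_{s=0}^m\binom{m+\alpha}{m-s}\binom{m+\beta}{s}(t-1)^s(t+1)^{m-s}$ are the Jacobi polynomials. Set $Y_{k-1}^j=\partial_xH_k^j$ and $$F_{k-1}^n=Y_{k-1}^{2n}-Y_{k-1}^{2n+1}e_{12},\qquad n=0,\dots,k-1$$ (so $F_{k-1}^0=Y_{k-1}^0$). Then, for every $k\ge1$, the functions $F_{k-1}^0,\dots,F_{k-1}^{k-1}$ are pairwise orthogonal in $L^2(S^2)$, that is, $$\int_{S^2}\overline{F_{k-1}^n(\omega)}\,F_{k-1}^{n'}(\omega)\,d\omega=0\qquad(n\ne n'),$$ and they form a basis of the right $\mathbb R_3$-module $\mathcal M_\ell^+(k-1)$. -/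

import Mathlib

open MeasureTheory

noncomputable section

namespace SphMon

/-! ### The real Clifford algebra `ℝ₃` with `e_j ^ 2 = -1` -/

/-- The quadratic form `-(v₁² + v₂² + v₃²)`. -/
abbrev negDef : QuadraticForm ℝ (Fin 3 → ℝ) :=
  QuadraticMap.weightedSumSquares ℝ (fun _ : Fin 3 => (-1 : ℝ))

/-- The universal real Clifford algebra `ℝ₃`. Its `star` (Mathlib's instance) is the Hermitian
conjugation: the real-linear anti-automorphism sending every vector `v` to `-v`. -/
abbrev Cl3 : Type := CliffordAlgebra negDef

/-- The generators; `e 0, e 1, e 2` stand for `e₁, e₂, e₃`. -/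
def e (j : Fin 3) : Cl3 := CliffordAlgebra.ι negDef (Pi.single j 1)

theorem e_sq (j : Fin 3) : e j * e j = -1 := by
  unfold e
  rw [CliffordAlgebra.ι_sq_scalar]
  fin_cases j <;>
    simp [negDef, QuadraticMap.weightedSumSquares_apply, Pi.single_apply]

theorem e_anticomm {i j : Fin 3} (h : i ≠ j) : e i * e j = -(e j * e i) := by
  have key := CliffordAlgebra.ι_mul_ι_add_swap (Q := negDef) (Pi.single i 1) (Pi.single j 1)
  rw [eq_neg_iff_add_eq_zero]
  unfold e
  rw [key]
  revert h
  fin_cases i <;> fin_cases j <;>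
    simp [QuadraticMap.polar, negDef, QuadraticMap.weightedSumSquares_apply,
      Fin.sum_univ_three, Pi.single_apply]

theorem star_e (j : Fin 3) : star (e j) = -e j := CliffordAlgebra.star_ι _

/-- The standard basis `1, e₁, e₂, e₃, e₁₂, e₁₃, e₂₃, e₁₂₃` of `ℝ₃`. -/
def eBlade : Fin 8 → Cl3 :=
  ![1, e 0, e 1, e 2, e 0 * e 1, e 0 * e 2, e 1 * e 2, e 0 * e 1 * e 2]

/-- The linear map `v ↦ s (v₁ i + v₂ j + v₃ k)` into the quaternions. -/
def quatVec (s : ℝ) : (Fin 3 → ℝ) →ₗ[ℝ] QuaternionAlgebra ℝ (-1) 0 (-1) where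
  toFun v := ⟨0, s * v 0, s * v 1, s * v 2⟩
  map_add' u v := by ext <;> simp [mul_add]
  map_smul' c v := by ext <;> simp <;> ring

theorem quatVec_sq (s : ℝ) (hs : s * s = 1) (v : Fin 3 → ℝ) :
    quatVec s v * quatVec s v = algebraMap ℝ (QuaternionAlgebra ℝ (-1) 0 (-1)) (negDef v) := by
  ext <;> simp [quatVec, negDef, QuadraticMap.weightedSumSquares_apply, Fin.sum_univ_three]
  · linear_combination (-(v 0 * v 0) - v 1 * v 1 - v 2 * v 2) * hs
  all_goals ring
/-- The algebra homomorphism `ℝ₃ → ℍ` with `e₁, e₂, e₃ ↦ s i, s j, s k`, for `s = ±1`. -/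
def toQuat (s : ℝ) (hs : s * s = 1) : Cl3 →ₐ[ℝ] QuaternionAlgebra ℝ (-1) 0 (-1) :=
  CliffordAlgebra.lift negDef ⟨quatVec s, quatVec_sq s hs⟩

theorem toQuat_e (s : ℝ) (hs : s * s = 1) (j : Fin 3) :
    toQuat s hs (e j) = quatVec s (Pi.single j 1) := by
  unfold toQuat e
  exact CliffordAlgebra.lift_ι_apply _ _ _

theorem linearIndependent_eBlade : LinearIndependent ℝ eBlade := by
  rw [Fintype.linearIndependent_iff]
  intro g hg
  have h1 := congrArg (toQuat 1 (by norm_num)) hg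
  have h2 := congrArg (toQuat (-1) (by norm_num)) hg
  simp only [Fin.sum_univ_eight, eBlade] at h1 h2
  simp [toQuat_e, quatVec, QuaternionAlgebra.ext_iff] at h1 h2
  obtain ⟨a1, a2, a3, a4⟩ := h1
  obtain ⟨b1, b2, b3, b4⟩ := h2
  intro i
  fin_cases i <;> simp <;> linarith

theorem span_eBlade : ⊤ ≤ Submodule.span ℝ (Set.range eBlade) := by
  set S := Submodule.span ℝ (Set.range eBlade) with hS
  have hb : ∀ i, eBlade i ∈ S := fun i => Submodule.subset_span ⟨i, rfl⟩
  have h00 := e_sq 0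
  have h11 := e_sq 1
  have h22 := e_sq 2
  have h10 : e 1 * e 0 = -(e 0 * e 1) := e_anticomm (by decide)
  have h20 : e 2 * e 0 = -(e 0 * e 2) := e_anticomm (by decide)
  have h21 : e 2 * e 1 = -(e 1 * e 2) := e_anticomm (by decide)
  have c00 : ∀ z, e 0 * (e 0 * z) = -z := fun z => by rw [← mul_assoc, h00]; simp
  have c11 : ∀ z, e 1 * (e 1 * z) = -z := fun z => by rw [← mul_assoc, h11]; simp
  have c10 : ∀ z, e 1 * (e 0 * z) = -(e 0 * (e 1 * z)) := fun z => by
    rw [← mul_assoc, h10]; simp [mul_assoc]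
  have c20 : ∀ z, e 2 * (e 0 * z) = -(e 0 * (e 2 * z)) := fun z => by
    rw [← mul_assoc, h20]; simp [mul_assoc]
  have c21 : ∀ z, e 2 * (e 1 * z) = -(e 1 * (e 2 * z)) := fun z => by
    rw [← mul_assoc, h21]; simp [mul_assoc]
  have m0 : (1 : Cl3) ∈ S := hb 0
  have m1 : e 0 ∈ S := hb 1
  have m2 : e 1 ∈ S := hb 2
  have m3 : e 2 ∈ S := hb 3
  have m4 : e 0 * e 1 ∈ S := hb 4
  have m5 : e 0 * e 2 ∈ S := hb 5
  have m6 : e 1 * e 2 ∈ S := hb 6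
  have m7 : e 0 * (e 1 * e 2) ∈ S := by rw [← mul_assoc]; exact hb 7
  have hmul : ∀ j, ∀ x ∈ S, e j * x ∈ S := by
    intro j x hx
    induction hx using Submodule.span_induction with
    | mem x hx =>
      obtain ⟨i, rfl⟩ := hx
      fin_cases j <;> fin_cases i <;>
        simp [eBlade, mul_assoc, h00, h11, h22, h10, h20, h21, c00, c11, c10, c20, c21,
          m0, m1, m2, m3, m4, m5, m6, m7]
    | zero => simp
    | add x y _ _ hx hy => rw [mul_add]; exact S.add_mem hx hy
    | smul a x _ hx => rw [mul_smul_comm]; exact S.smul_mem a hx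
  intro x _
  induction x using CliffordAlgebra.left_induction with
  | algebraMap r =>
    rw [Algebra.algebraMap_eq_smul_one]
    exact S.smul_mem r m0
  | add x y hx hy => exact S.add_mem (hx trivial) (hy trivial)
  | ι_mul x m hx =>
    have hm : CliffordAlgebra.ι negDef m = ∑ j, m j • e j := by
      conv_lhs => rw [← Finset.univ_sum_single m]
      rw [map_sum]
      refine Finset.sum_congr rfl fun j _ => ?_
      rw [e, ← map_smul, ← Pi.single_smul, smul_eq_mul, mul_one]
    rw [hm, Finset.sum_mul]
    refine S.sum_mem fun j _ => ?_
    rw [smul_mul_assoc]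
    exact S.smul_mem _ (hmul j _ (hx trivial))

/-- `1, e₁, e₂, e₃, e₁₂, e₁₃, e₂₃, e₁₂₃` as a real basis of `ℝ₃`. -/
def bladeBasis : Module.Basis (Fin 8) ℝ Cl3 :=
  Module.Basis.mk linearIndependent_eBlade span_eBlade

/-- The coordinates `(λ_A)_A` of a Clifford number, as a vector of Euclidean space. -/
def coords : Cl3 →ₗ[ℝ] EuclideanSpace ℝ (Fin 8) :=
  ((WithLp.linearEquiv 2 ℝ (Fin 8 → ℝ)).symm.toLinearMap).comp bladeBasis.equivFun.toLinearMap

theorem coords_injective : Function.Injective coords :=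
  (WithLp.linearEquiv 2 ℝ (Fin 8 → ℝ)).symm.injective.comp bladeBasis.equivFun.injective

/-- The norm `|λ|² = ∑_A λ_A²` on `ℝ₃`. -/
instance : NormedAddCommGroup Cl3 :=
  NormedAddCommGroup.induced Cl3 (EuclideanSpace ℝ (Fin 8)) coords coords_injective

instance : NormedSpace ℝ Cl3 :=
  NormedSpace.induced ℝ Cl3 (EuclideanSpace ℝ (Fin 8)) coords

instance : FiniteDimensional ℝ Cl3 := bladeBasis.finiteDimensional_of_finite

/-! ### The Dirac operator and spherical monogenics on `ℝ³` -/

/-- Euclidean three-space; `x 0, x 1, x 2` stand for `x₁, x₂, x₃`. -/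
abbrev E3 : Type := EuclideanSpace ℝ (Fin 3)

/-- The Dirac operator `∂ₓ f = ∑_j e_j ∂f/∂x_j`. -/
def dirac (f : E3 → Cl3) (x : E3) : Cl3 :=
  ∑ j, e j * fderiv ℝ f x (EuclideanSpace.single j 1)

/-- Left monogenic functions on `ℝ³`. -/
def IsLeftMonogenic (f : E3 → Cl3) : Prop :=
  ContDiff ℝ 1 f ∧ ∀ x, dirac f x = 0

/-- `f(x) = ∑_{|α| = d} x^α c_α` with coefficients `c_α ∈ ℝ₃`. -/
def IsHomogPoly (d : ℕ) (f : E3 → Cl3) : Prop :=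
  ∃ c : (Fin 3 → ℕ) → Cl3, ∀ x : E3,
    f x = ∑ α ∈ Finset.piAntidiag Finset.univ d, (∏ i, x i ^ α i) • c α

/-- Right multiplication by `a`, as a continuous real-linear map. -/
def mulRightL (a : Cl3) : Cl3 →L[ℝ] Cl3 :=
  LinearMap.toContinuousLinearMap (LinearMap.mulRight ℝ a)

/-- The right `ℝ₃`-module of left monogenic homogeneous polynomials of degree `d` on `ℝ³`
(a right module is a module over the opposite ring, `MulOpposite.op a` acting by `f ↦ f a`). -/
def monogenics (d : ℕ) : Submodule Cl3ᵐᵒᵖ (E3 → Cl3) where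
  carrier := {f | IsHomogPoly d f ∧ IsLeftMonogenic f}
  zero_mem' := by
    refine ⟨⟨fun _ => 0, fun x => by simp⟩, contDiff_const, fun x => ?_⟩
    have h : fderiv ℝ (0 : E3 → Cl3) x = 0 := fderiv_const_apply (0 : Cl3)
    simp [dirac, h]
  add_mem' := by
    rintro f g ⟨⟨c, hc⟩, hf1, hf2⟩ ⟨⟨c', hc'⟩, hg1, hg2⟩
    refine ⟨⟨fun α => c α + c' α, fun x => ?_⟩, hf1.add hg1, fun x => ?_⟩
    · simp [hc, hc', Finset.sum_add_distrib]
    · have h := fderiv_add (hf1.differentiable one_ne_zero x)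
        (hg1.differentiable one_ne_zero x)
      have h2 := hf2 x
      have h3 := hg2 x
      unfold dirac at *
      simp only [h, add_apply, mul_add, Finset.sum_add_distrib, h2, h3,
        add_zero]
  smul_mem' := by
    rintro a f ⟨⟨c, hc⟩, hf1, hf2⟩
    have ha : a • f = fun x => mulRightL a.unop (f x) := rfl
    refine ⟨⟨fun α => c α * a.unop, fun x => ?_⟩, ?_, fun x => ?_⟩
    · change f x * a.unop = _
      simp [hc, Finset.sum_mul]
    · rw [ha]
      exact (mulRightL a.unop).contDiff.comp hf1
    · have h : fderiv ℝ (a • f) x = (mulRightL a.unop).comp (fderiv ℝ f x) := by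
        rw [ha]
        exact ((mulRightL a.unop).hasFDerivAt.comp x
          (hf1.differentiable one_ne_zero x).hasFDerivAt).fderiv
      have h2 := hf2 x
      unfold dirac at *
      rw [h]
      have h3 : ∀ y, mulRightL a.unop y = y * a.unop := fun y => rfl
      simp only [ContinuousLinearMap.comp_apply, h3, ← mul_assoc, ← Finset.sum_mul, h2, zero_mul]

/-! ### The spherical harmonics and the functions built from them -/

/-- The Jacobi polynomial `P_m^{(a,b)}(t)`, for natural parameters `a` and `b`. -/
def jacobiP (m a b : ℕ) (t : ℝ) : ℝ :=
  (2 : ℝ)⁻¹ ^ m * ∑ s ∈ Finset.range (m + 1),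
    ((m + a).choose (m - s) : ℝ) * ((m + b).choose s : ℝ) * (t - 1) ^ s * (t + 1) ^ (m - s)

/-- The polar angle `φ ∈ [0, π]` of `x = (r cos θ sin φ, r sin θ sin φ, r cos φ)`. -/
def polar (x : E3) : ℝ := Real.arccos (x 2 / ‖x‖)

/-- The azimuthal angle `θ`, taken in `(-π, π]`. -/
def azimuth (x : E3) : ℝ := Complex.arg ⟨x 0, x 1⟩

/-- The spherical harmonic `H_k^j`, for `j = 0`, `j = 2n` and `j = 2n + 1`. The last formula at
`n = 0` gives `H_k^1 = 0`. -/
def harmonic (k j : ℕ) (x : E3) : ℝ :=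
  if j = 0 then
    ‖x‖ ^ k / √(8 * Real.pi) * jacobiP k 0 0 (Real.cos (polar x))
  else
    ‖x‖ ^ k / (2 ^ (j / 2 + 1) * √Real.pi) * Real.sin (polar x) ^ (j / 2) *
      jacobiP (k - j / 2) (j / 2) (j / 2) (Real.cos (polar x)) *
      (if Even j then Real.cos ((j / 2 : ℕ) * azimuth x)
        else Real.sin ((j / 2 : ℕ) * azimuth x))

/-- `Y_{k-1}^j = ∂ₓ H_k^j`. -/
def diracHarmonic (k j : ℕ) : E3 → Cl3 :=
  dirac fun x => algebraMap ℝ Cl3 (harmonic k j x)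

/-- `F_{k-1}^n = Y_{k-1}^{2n} - Y_{k-1}^{2n+1} e₁₂`. -/
def monogenicF (k n : ℕ) (x : E3) : Cl3 :=
  diracHarmonic k (2 * n) x - diracHarmonic k (2 * n + 1) x * (e 0 * e 1)

/-- The surface measure of the unit sphere `S²`. -/
abbrev surfaceMeasure : Measure (Metric.sphere (0 : E3) 1) := (volume : Measure E3).toSphere

end SphMon

end

noncomputable section

namespace SphMon

/-! ### Solid harmonics as complex polynomials -/

/-! Embed `ℂ` in `ℝ₃` by `i ↦ e₁₂`. Then `H_k^{2n} - H_k^{2n+1} e₁₂` is the image of one complex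
polynomial, a real multiple of `solid n k` (`harmonic_eq_solid`), and `F_{k-1}^n` is its Dirac
derivative. Written in divided powers of `ζ = x₁ + i x₂`, `ζ̄` and `x₃`, the partial derivatives of
`solid` only shift its indices, so `F_d^n` is a nonzero real multiple of `e₃ S_n - e₁ S_{n+1} / 2`
with `S_n = solid n d` (`monogenicF_eq`), and its monogenicity is an index check.

Orthogonality comes from rotations about the third axis: `S_n` has weight `e^(-inα)`, so for `n ≠ m`
every term of `star F_n * F_m` has nontrivial weight and integrates to zero
(`integral_star_solidMonogenic_mul`).

The diagonal integrals are nonzero real scalars, so pairing a relation with each `F_m` gives right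
linear independence. Spanning is a dimension count over `ℝ`. A homogeneous monogenic polynomial is
determined by its restriction to `x₃ = 0` (`eq_zero_of_dirac_eq_zero`), where only `d + 1` monomials
of degree `d` survive. The space therefore has at most the real dimension of `Fin (d + 1) → Cl3`,
which the right combinations of the `F_d^n` already attain. -/

/-- The complex coordinate `x₁ + i x₂` on `ℝ³`. -/
def zetaL : E3 →L[ℝ] ℂ :=
  Complex.ofRealCLM.comp (EuclideanSpace.proj 0) +
    Complex.I • Complex.ofRealCLM.comp (EuclideanSpace.proj 1)

/-- The conjugate coordinate `x₁ - i x₂` on `ℝ³`. -/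
def zetaBarL : E3 →L[ℝ] ℂ :=
  Complex.ofRealCLM.comp (EuclideanSpace.proj 0) -
    Complex.I • Complex.ofRealCLM.comp (EuclideanSpace.proj 1)

/-- The coordinate `x₃`, as a complex number. -/
def heightL : E3 →L[ℝ] ℂ := Complex.ofRealCLM.comp (EuclideanSpace.proj 2)

theorem zetaL_apply (x : E3) : zetaL x = x 0 + Complex.I * x 1 := rfl

theorem zetaBarL_apply (x : E3) : zetaBarL x = x 0 - Complex.I * x 1 := rfl

theorem heightL_apply (x : E3) : heightL x = x 2 := rfl

theorem zetaBarL_eq_conj (x : E3) : zetaBarL x = starRingEnd ℂ (zetaL x) := by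
  simp [zetaL_apply, zetaBarL_apply, sub_eq_add_neg]

/-- The divided power `w ^ j / j!`. -/
def divPow (j : ℕ) (w : ℂ) : ℂ := w ^ j / j.factorial

/-- The derivative of the divided power `w ^ j / j!`. -/
def divPowDeriv : ℕ → ℂ → ℂ
  | 0, _ => 0
  | j + 1, w => divPow j w

theorem hasFDerivAt_divPow (L : E3 →L[ℝ] ℂ) (j : ℕ) (x : E3) :
    HasFDerivAt (fun y => divPow j (L y)) (divPowDeriv j (L x) • L) x := by
  cases j with
  | zero =>
    refine (hasFDerivAt_const (𝕜 := ℝ) (divPow 0 0) x).congr_fderiv ?_ |>.congr_of_eventuallyEq ?_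
    · ext v
      simp [divPowDeriv]
    · exact Filter.Eventually.of_forall fun y => by simp [divPow]
  | succ j =>
    refine (((L.hasFDerivAt (x := x)).pow (j + 1)).mul_const
      ((((j + 1).factorial : ℕ) : ℂ)⁻¹)).congr_fderiv ?_
    ext v
    have h1 : ((j : ℂ) + 1) ≠ 0 := by exact_mod_cast Nat.succ_ne_zero j
    have h2 : (j.factorial : ℂ) ≠ 0 := by exact_mod_cast j.factorial_ne_zero
    simp [divPowDeriv, divPow, Nat.factorial_succ]
    field_simp

/-- The solid harmonic of degree `d` that transforms by `e ^ (-i n θ)` under rotations about the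
third axis, as a sum of products of divided powers of `x₁ + i x₂`, `x₁ - i x₂` and `x₃`. -/
def solid (n d : ℕ) (x : E3) : ℂ :=
  ∑ j ∈ Finset.range (d + 1), if n + 2 * j ≤ d then
    (-1 / 4) ^ j * (divPow j (zetaL x) * divPow (n + j) (zetaBarL x) *
      divPow (d - n - 2 * j) (heightL x)) else 0

/-- The derivative of `solid n d` in the conjugate coordinate. -/
def solidBar (n d : ℕ) (x : E3) : ℂ :=
  ∑ j ∈ Finset.range (d + 1), if n + 2 * j ≤ d then
    (-1 / 4) ^ j * (divPow j (zetaL x) * divPowDeriv (n + j) (zetaBarL x) *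
      divPow (d - n - 2 * j) (heightL x)) else 0

/-- For `n = 0` the `ζ̄`-derivative has weight of the opposite sign and is not of the form `solid`.
This is why `solidBar` is kept as a separate symbol; it drops out wherever only `∂₁ - i∂₂` acts. -/
theorem solidBar_succ (n d : ℕ) (x : E3) : solidBar (n + 1) (d + 1) x = solid n d x := by
  unfold solidBar solid
  rw [Finset.sum_range_succ, if_neg (by omega), add_zero]
  refine Finset.sum_congr rfl fun j _ => ?_
  have h : n + 1 + j = (n + j) + 1 := by ring
  by_cases hj : n + 2 * j ≤ d
  · rw [if_pos hj, if_pos (by omega), h, divPowDeriv]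
    congr 4
    omega
  · rw [if_neg hj, if_neg (by omega)]

theorem hasFDerivAt_solid_aux (n d : ℕ) (x : E3) :
    HasFDerivAt (solid n d)
      ((∑ j ∈ Finset.range (d + 1), if n + 2 * j ≤ d then
          (-1 / 4) ^ j * (divPowDeriv j (zetaL x) * divPow (n + j) (zetaBarL x) *
            divPow (d - n - 2 * j) (heightL x)) else 0) • zetaL +
        solidBar n d x • zetaBarL +
        (∑ j ∈ Finset.range (d + 1), if n + 2 * j ≤ d then
          (-1 / 4) ^ j * (divPow j (zetaL x) * divPow (n + j) (zetaBarL x) *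
            divPowDeriv (d - n - 2 * j) (heightL x)) else 0) • heightL) x := by
  have hj (j : ℕ) : HasFDerivAt (fun x => if n + 2 * j ≤ d then
      (-1 / 4 : ℂ) ^ j * (divPow j (zetaL x) * divPow (n + j) (zetaBarL x) *
        divPow (d - n - 2 * j) (heightL x)) else 0)
      ((if n + 2 * j ≤ d then
          (-1 / 4 : ℂ) ^ j * (divPowDeriv j (zetaL x) * divPow (n + j) (zetaBarL x) *
            divPow (d - n - 2 * j) (heightL x)) else 0) • zetaL +
        (if n + 2 * j ≤ d then
          (-1 / 4 : ℂ) ^ j * (divPow j (zetaL x) * divPowDeriv (n + j) (zetaBarL x) *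
            divPow (d - n - 2 * j) (heightL x)) else 0) • zetaBarL +
        (if n + 2 * j ≤ d then
          (-1 / 4 : ℂ) ^ j * (divPow j (zetaL x) * divPow (n + j) (zetaBarL x) *
            divPowDeriv (d - n - 2 * j) (heightL x)) else 0) • heightL) x := by
    by_cases hj : n + 2 * j ≤ d
    · simp only [if_pos hj]
      refine ((((hasFDerivAt_divPow zetaL j x).mul (hasFDerivAt_divPow zetaBarL (n + j) x)).mul
        (hasFDerivAt_divPow heightL (d - n - 2 * j) x)).const_mul
          ((-1 / 4 : ℂ) ^ j)).congr_fderiv ?_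
      ext v
      simp
      ring
    · simp only [if_neg hj]
      refine (hasFDerivAt_const (𝕜 := ℝ) (0 : ℂ) x).congr_fderiv ?_
      ext v
      simp
  refine (HasFDerivAt.fun_sum (u := Finset.range (d + 1)) fun j _ => hj j).congr_fderiv ?_
  ext v
  simp only [solidBar, add_apply, smul_apply, sum_apply, smul_eq_mul, Finset.sum_mul,
    Finset.sum_add_distrib]

/-- Differentiating a divided power lowers its exponent by one with no constant. Thus `∂_ζ` raises
`n` with factor `-1/4`, while `∂_{x₃}` only lowers the degree. -/
theorem hasFDerivAt_solid (n d : ℕ) (x : E3) :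
    HasFDerivAt (solid n (d + 1))
      ((-1 / 4 * solid (n + 1) d x) • zetaL + solidBar n (d + 1) x • zetaBarL +
        solid n d x • heightL) x := by
  convert hasFDerivAt_solid_aux n (d + 1) x using 4
  -- The `j = 0` term has no `ζ` to differentiate; shifting `j` by one produces the factor `-1/4`.
  · rw [Finset.sum_range_succ', solid, Finset.mul_sum]
    simp only [divPowDeriv, zero_mul, mul_zero, ite_self, add_zero]
    refine Finset.sum_congr rfl fun j _ => ?_
    by_cases hj : n + 1 + 2 * j ≤ d
    · rw [if_pos hj, if_pos (by omega), show n + (j + 1) = n + 1 + j by ring,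
        show d + 1 - n - 2 * (j + 1) = d - (n + 1) - 2 * j by omega]
      ring
    · rw [if_neg hj, if_neg (by omega), mul_zero]
  · rw [Finset.sum_range_succ, if_neg (by omega), add_zero, solid]
    refine Finset.sum_congr rfl fun j _ => ?_
    by_cases hj : n + 2 * j ≤ d
    · rw [if_pos hj, if_pos (by omega), show d + 1 - n - 2 * j = d - n - 2 * j + 1 by omega,
        divPowDeriv]
    · rw [if_neg hj]
      -- Here `n + 2 * j = d + 1`, so the term is constant in `x₃`.
      split_ifs with h
      · rw [show d + 1 - n - 2 * j = 0 by omega, divPowDeriv, mul_zero, mul_zero]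
      · rfl

theorem solid_zero (n : ℕ) (x : E3) : solid n 0 x = if n = 0 then 1 else 0 := by
  simp only [solid, zero_add, Finset.sum_range_one, mul_zero, add_zero, Nat.le_zero_eq]
  split_ifs with h
  · simp [h, divPow]
  · rfl

theorem contDiff_solid (n d : ℕ) : ContDiff ℝ ⊤ (solid n d) := by
  refine ContDiff.sum fun j _ => ?_
  split_ifs
  · unfold divPow
    fun_prop
  · exact contDiff_const

theorem solid_smul (n d : ℕ) (t : ℝ) (x : E3) : solid n d (t • x) = (t : ℂ) ^ d * solid n d x := by
  simp only [solid, Finset.mul_sum]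
  refine Finset.sum_congr rfl fun j _ => ?_
  split_ifs with h
  · obtain ⟨m, rfl⟩ := Nat.exists_eq_add_of_le h
    rw [show n + 2 * j + m - n - 2 * j = m by omega]
    simp only [map_smul, divPow, Complex.real_smul, mul_pow]
    ring
  · rw [mul_zero]

/-- The effect of a rotation about the third axis. -/
theorem solid_rotate (n d : ℕ) (x y : E3) (c : ℂ) (hc : ‖c‖ = 1) (h : zetaL y = c * zetaL x)
    (h3 : y 2 = x 2) : solid n d y = starRingEnd ℂ c ^ n * solid n d x := by
  have hb : zetaBarL y = starRingEnd ℂ c * zetaBarL x := by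
    rw [zetaBarL_eq_conj, h, map_mul, ← zetaBarL_eq_conj]
  have hcc : c * starRingEnd ℂ c = 1 := by
    rw [Complex.mul_conj, Complex.normSq_eq_norm_sq, hc]; simp
  simp only [solid, Finset.mul_sum]
  refine Finset.sum_congr rfl fun j _ => ?_
  split_ifs
  · rw [h, hb, heightL_apply, h3, ← heightL_apply]
    simp only [divPow, mul_pow, pow_add]
    have : c ^ j * starRingEnd ℂ c ^ j = 1 := by rw [← mul_pow, hcc, one_pow]
    linear_combination (starRingEnd ℂ c ^ n * (-1 / 4) ^ j * (zetaL x ^ j / j.factorial *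
      (zetaBarL x ^ n * zetaBarL x ^ j / (n + j).factorial) *
      (heightL x ^ (d - n - 2 * j) / (d - n - 2 * j).factorial))) * this
  · rw [mul_zero]

/-- If a solid harmonic vanished identically, so would its derivatives. `∂_{x₃}` brings `solid 0 d`
down to `solid 0 0 = 1`, and `∂_ζ̄` brings `solid (n + 1) (d + 1)` down to `solid n d`. -/
theorem exists_solid_ne_zero (n d : ℕ) (h : n ≤ d) : ∃ x, solid n d x ≠ 0 := by
  have hz : ∀ d, ∃ x, solid 0 d x ≠ 0 := by
    intro d
    induction d with
    | zero => exact ⟨0, by simp [solid_zero]⟩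
    | succ d ih =>
      obtain ⟨x, hx⟩ := ih
      by_contra! H
      have h1 := (hasFDerivAt_solid 0 d x).unique
        ((funext H : solid 0 (d + 1) = fun _ => 0) ▸ hasFDerivAt_const (0 : ℂ) x)
      have h2 := congrArg (fun L => L (EuclideanSpace.single 2 1)) h1
      simp [zetaL_apply, zetaBarL_apply, heightL_apply] at h2
      exact hx h2
  induction n generalizing d with
  | zero => exact hz d
  | succ n ih =>
    obtain ⟨d, rfl⟩ := Nat.exists_eq_add_of_le' (show 1 ≤ d by omega)
    obtain ⟨x, hx⟩ := ih d (by omega)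
    by_contra! H
    have h1 := (hasFDerivAt_solid (n + 1) d x).unique
      ((funext H : solid (n + 1) (d + 1) = fun _ => 0) ▸ hasFDerivAt_const (0 : ℂ) x)
    have h2 := congrArg (fun L => L (EuclideanSpace.single 0 1)) h1
    have h3 := congrArg (fun L => L (EuclideanSpace.single 1 1)) h1
    simp [zetaL_apply, zetaBarL_apply, heightL_apply, solidBar_succ] at h2 h3
    apply hx
    -- `∂_ζ̄ = (∂₁ + i∂₂) / 2` cancels the `ζ`-derivative and leaves `solid n d`.
    linear_combination (1 / 2) * h2 + Complex.I / 2 * h3 +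
      (-1 / 4 * solid (n + 1 + 1) d x - solid n d x) / (-2) * Complex.I_sq

theorem exists_sphere_solid_ne_zero (n d : ℕ) (h : n ≤ d) :
    ∃ x : Metric.sphere (0 : E3) 1, solid n d x ≠ 0 := by
  obtain ⟨x, hx⟩ := exists_solid_ne_zero n d h
  obtain ⟨y, hy, t, rfl⟩ : ∃ y : E3, ‖y‖ = 1 ∧ ∃ t : ℝ, x = t • y := by
    by_cases h0 : x = 0
    · exact ⟨EuclideanSpace.single 0 1, by simp, 0, by simp [h0]⟩
    · refine ⟨‖x‖⁻¹ • x, norm_smul_inv_norm h0, ‖x‖, ?_⟩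
      rw [smul_smul, mul_inv_cancel₀ (norm_ne_zero_iff.2 h0), one_smul]
  refine ⟨⟨y, by simp [hy]⟩, fun h0 => hx ?_⟩
  rw [solid_smul, h0, mul_zero]

/-- `solid n d` as a complex polynomial in three variables. -/
theorem exists_solid_eq_eval (n d : ℕ) : ∃ P : MvPolynomial (Fin 3) ℂ, P.IsHomogeneous d ∧
    ∀ x : E3, solid n d x = P.eval fun i => (x i : ℂ) := by
  open MvPolynomial in
  refine ⟨∑ j ∈ Finset.range (d + 1), if n + 2 * j ≤ d then
    C ((-1 / 4) ^ j * ((j.factorial : ℂ)⁻¹ * ((n + j).factorial : ℂ)⁻¹ *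
      ((d - n - 2 * j).factorial : ℂ)⁻¹)) * ((X 0 + C Complex.I * X 1) ^ j *
      (X 0 - C Complex.I * X 1) ^ (n + j) * X 2 ^ (d - n - 2 * j)) else 0, ?_, ?_⟩
  · refine IsHomogeneous.sum _ _ _ fun j _ => ?_
    split_ifs with h
    · have hI : (C Complex.I * X 1 : MvPolynomial (Fin 3) ℂ).IsHomogeneous 1 := by
        simpa using (isHomogeneous_C (Fin 3) Complex.I).mul (isHomogeneous_X ℂ (1 : Fin 3))
      have h1 := ((isHomogeneous_X ℂ (0 : Fin 3)).add hI).pow j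
      have h2 := ((isHomogeneous_X ℂ (0 : Fin 3)).sub hI).pow (n + j)
      have h3 := (isHomogeneous_X ℂ (2 : Fin 3)).pow (d - n - 2 * j)
      have h4 := (isHomogeneous_C (Fin 3) ((-1 / 4) ^ j * ((j.factorial : ℂ)⁻¹ *
        ((n + j).factorial : ℂ)⁻¹ * ((d - n - 2 * j).factorial : ℂ)⁻¹))).mul ((h1.mul h2).mul h3)
      convert h4 using 1
      omega
    · exact isHomogeneous_zero _ _ _
  · intro x
    rw [map_sum, solid]
    refine Finset.sum_congr rfl fun j _ => ?_
    split_ifs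
    · simp [divPow, zetaL_apply, zetaBarL_apply, heightL_apply]
      ring
    · simp

/-! ### The complex subalgebra of `ℝ₃` generated by `e₁₂` -/

theorem e12_sq : (e 0 * e 1) * (e 0 * e 1) = -1 := by
  have h : e 1 * e 0 = -(e 0 * e 1) := e_anticomm (by decide)
  rw [mul_assoc, ← mul_assoc (e 1), h, neg_mul, mul_assoc (e 0) (e 1), e_sq]
  simp [e_sq]

/-- The embedding `ℂ → ℝ₃` sending `i` to `e₁₂`. -/
def cplx : ℂ →ₐ[ℝ] Cl3 := Complex.lift ⟨e 0 * e 1, e12_sq⟩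

theorem cplx_apply (w : ℂ) : cplx w = algebraMap ℝ Cl3 w.re + w.im • (e 0 * e 1) := by
  rw [cplx, Complex.lift_apply, Complex.liftAux_apply]

theorem cplx_ofReal (r : ℝ) : cplx (r : ℂ) = algebraMap ℝ Cl3 r := by
  simp

theorem cplx_I : cplx Complex.I = e 0 * e 1 := by
  simp [cplx_apply]

/-- `e 0` anticommutes with `e₁₂`, so moving it across the image of `ℂ` conjugates; `e 2` commutes
with `e₁₂`. -/
theorem cplx_mul_e_zero (w : ℂ) : cplx w * e 0 = e 0 * cplx (starRingEnd ℂ w) := by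
  have h : e 1 * e 0 = -(e 0 * e 1) := e_anticomm (by decide)
  simp only [cplx_apply, add_mul, mul_add, smul_mul_assoc, mul_smul_comm, Complex.conj_re,
    Complex.conj_im, mul_assoc, h]
  rw [Algebra.commutes]
  simp

theorem cplx_mul_e_two (w : ℂ) : cplx w * e 2 = e 2 * cplx w := by
  have h : e 1 * e 2 = -(e 2 * e 1) := e_anticomm (by decide)
  have h' : e 0 * e 2 = -(e 2 * e 0) := e_anticomm (by decide)
  simp only [cplx_apply, add_mul, mul_add, smul_mul_assoc, mul_smul_comm, mul_assoc, h]
  rw [Algebra.commutes, mul_neg, ← mul_assoc (e 0), h', neg_mul, neg_neg, mul_assoc]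

theorem star_cplx (w : ℂ) : star (cplx w) = cplx (starRingEnd ℂ w) := by
  have h : e 1 * e 0 = -(e 0 * e 1) := e_anticomm (by decide)
  rw [cplx_apply, cplx_apply, star_add, CliffordAlgebra.star_algebraMap, CliffordAlgebra.star_smul,
    star_mul, star_e, star_e, neg_mul_neg, h]
  simp

/-- Eliminating `e 1` turns `e₁∂₁ + e₂∂₂` into `e₁(∂₁ - i∂₂)`, so complex derivatives can be used.
-/
theorem e_one_eq : e 1 = -(e 0 * cplx Complex.I) := by
  rw [cplx_I, ← mul_assoc, e_sq, neg_one_mul, neg_neg]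

/-- Left multiplication by `a` on the image of `ℂ`, as a continuous real-linear map. -/
def mulCplxL (a : Cl3) : ℂ →L[ℝ] Cl3 :=
  LinearMap.toContinuousLinearMap ((LinearMap.mulLeft ℝ a).comp cplx.toLinearMap)

theorem mulCplxL_apply (a : Cl3) (w : ℂ) : mulCplxL a w = a * cplx w := rfl

theorem dirac_sub {f g : E3 → Cl3} {x : E3} (hf : DifferentiableAt ℝ f x)
    (hg : DifferentiableAt ℝ g x) : dirac (fun y => f y - g y) x = dirac f x - dirac g x := by
  simp only [dirac, fderiv_fun_sub hf hg, sub_apply, mul_sub, Finset.sum_sub_distrib]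

theorem hasFDerivAt_mul_cplx (a : Cl3) {g : E3 → ℂ} {g' : E3 →L[ℝ] ℂ} {x : E3}
    (h : HasFDerivAt g g' x) :
    HasFDerivAt (fun y => a * cplx (g y)) ((mulCplxL a).comp g') x :=
  (mulCplxL a).hasFDerivAt.comp x h

theorem dirac_mul_cplx (a : Cl3) {g : E3 → ℂ} {g' : E3 →L[ℝ] ℂ} {x : E3}
    (h : HasFDerivAt g g' x) :
    dirac (fun y => a * cplx (g y)) x =
      ∑ j, e j * (a * cplx (g' (EuclideanSpace.single j 1))) := by
  rw [dirac, (hasFDerivAt_mul_cplx a h).fderiv]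
  rfl

/-- `∂ₓ` on functions with values in the complex subalgebra. -/
theorem dirac_cplx {g : E3 → ℂ} {g' : E3 →L[ℝ] ℂ} {x : E3} (h : HasFDerivAt g g' x) :
    dirac (fun y => cplx (g y)) x =
      e 0 * cplx (g' (EuclideanSpace.single 0 1) - Complex.I * g' (EuclideanSpace.single 1 1)) +
        e 2 * cplx (g' (EuclideanSpace.single 2 1)) := by
  have := dirac_mul_cplx 1 h
  simp only [one_mul] at this
  rw [this, Fin.sum_univ_three, e_one_eq, map_sub, map_mul, mul_sub]
  simp only [neg_mul, mul_assoc, sub_eq_add_neg]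

theorem dirac_e_zero_mul_cplx {g : E3 → ℂ} {g' : E3 →L[ℝ] ℂ} {x : E3} (h : HasFDerivAt g g' x) :
    dirac (fun y => e 0 * cplx (g y)) x =
      -cplx (g' (EuclideanSpace.single 0 1) + Complex.I * g' (EuclideanSpace.single 1 1)) +
        e 2 * e 0 * cplx (g' (EuclideanSpace.single 2 1)) := by
  rw [dirac_mul_cplx _ h, Fin.sum_univ_three, e_one_eq, map_add, map_mul]
  have h1 : e 0 * cplx Complex.I * (e 0 * cplx (g' (EuclideanSpace.single 1 1))) =
      cplx Complex.I * cplx (g' (EuclideanSpace.single 1 1)) := by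
    rw [mul_assoc, ← mul_assoc (cplx Complex.I), cplx_mul_e_zero, ← mul_assoc, ← mul_assoc, e_sq]
    simp
  rw [neg_mul, h1, ← mul_assoc, e_sq, ← mul_assoc (e 2)]
  noncomm_ring

theorem dirac_e_two_mul_cplx {g : E3 → ℂ} {g' : E3 →L[ℝ] ℂ} {x : E3} (h : HasFDerivAt g g' x) :
    dirac (fun y => e 2 * cplx (g y)) x =
      -(e 2 * e 0 * cplx (g' (EuclideanSpace.single 0 1) -
        Complex.I * g' (EuclideanSpace.single 1 1))) - cplx (g' (EuclideanSpace.single 2 1)) := by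
  have h02 : e 0 * e 2 = -(e 2 * e 0) := e_anticomm (by decide)
  rw [dirac_mul_cplx _ h, Fin.sum_univ_three, e_one_eq, map_sub, map_mul]
  have h1 : e 0 * cplx Complex.I * (e 2 * cplx (g' (EuclideanSpace.single 1 1))) =
      -(e 2 * e 0 * (cplx Complex.I * cplx (g' (EuclideanSpace.single 1 1)))) := by
    rw [mul_assoc, ← mul_assoc (cplx Complex.I), cplx_mul_e_two, ← mul_assoc, ← mul_assoc, h02]
    noncomm_ring
  rw [neg_mul, h1, ← mul_assoc, h02, ← mul_assoc (e 2) (e 2), e_sq]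
  noncomm_ring

/-! ### The spherical monogenics -/

/-- The normalized form of the functions `F_d^n`. -/
def solidMonogenic (n d : ℕ) (x : E3) : Cl3 :=
  e 2 * cplx (solid n d x) - e 0 * cplx (1 / 2 * solid (n + 1) d x)

theorem dirac_cplx_solid (n d : ℕ) (c : ℝ) (x : E3) :
    dirac (fun y => cplx (c * solid n (d + 1) y)) x = c • solidMonogenic n d x := by
  have h1 : ∀ a b a' b' : ℂ, a = -(c * a') → b = c * b' →
      e 0 * cplx a + e 2 * cplx b = c • (e 2 * cplx b' - e 0 * cplx a') := by
    rintro a b a' b' rfl rfl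
    rw [map_neg, smul_sub, ← mul_smul_comm, ← mul_smul_comm, ← map_smul, ← map_smul,
      Complex.real_smul, Complex.real_smul]
    noncomm_ring
  rw [dirac_cplx ((hasFDerivAt_solid n d x).const_mul (c : ℂ)), solidMonogenic]
  refine h1 _ _ _ _ ?_ ?_
  · simp [zetaL_apply, zetaBarL_apply, heightL_apply]
    linear_combination (c * (1 / 4) * solid (n + 1) d x +
      c * solidBar n (d + 1) x) * Complex.I_sq
  · simp [zetaL_apply, zetaBarL_apply, heightL_apply]

theorem contDiff_solidMonogenic (n d : ℕ) : ContDiff ℝ ⊤ (solidMonogenic n d) :=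
  ((mulCplxL (e 2)).contDiff.comp (contDiff_solid n d)).sub
    ((mulCplxL (e 0)).contDiff.comp (contDiff_const.mul (contDiff_solid (n + 1) d)))

theorem dirac_solidMonogenic (n d : ℕ) (x : E3) : dirac (solidMonogenic n d) x = 0 := by
  cases d with
  | zero =>
    have : solidMonogenic n 0 = fun _ => solidMonogenic n 0 0 := by
      funext y
      simp only [solidMonogenic, solid_zero]
    rw [this]
    simp [dirac]
  | succ d =>
    have hA := hasFDerivAt_solid n d x
    have hB := (hasFDerivAt_solid (n + 1) d x).const_mul (1 / 2 : ℂ)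
    unfold solidMonogenic
    rw [dirac_sub (hasFDerivAt_mul_cplx _ hA).differentiableAt
      (hasFDerivAt_mul_cplx _ hB).differentiableAt, dirac_e_two_mul_cplx hA,
      dirac_e_zero_mul_cplx hB]
    have hI := Complex.I_sq
    -- For `e₃A - e₁B` the equation `∂ₓ = 0` splits into the Cauchy–Riemann type system `(∂₁ - i∂₂)A
    -- = -∂₃B`, `∂₃A = (∂₁ + i∂₂)B`. The factor `1/2` in `solidMonogenic` is what satisfies both.
    have h1 : ∀ a b c a' b' c' : ℂ, a = -c' → c = b' →
        -(e 2 * e 0 * cplx a) - cplx c - (-cplx b' + e 2 * e 0 * cplx c') = 0 := by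
      rintro a b c a' b' c' rfl rfl
      rw [map_neg]
      noncomm_ring
    refine h1 _ 0 _ 0 _ _ ?_ ?_
    · simp [zetaL_apply, zetaBarL_apply, heightL_apply]
      linear_combination (1 / 4 * solid (n + 1) d x + solidBar n (d + 1) x) * hI
    · simp [zetaL_apply, zetaBarL_apply, heightL_apply, solidBar_succ]
      linear_combination (1 / 8 * solid (n + 1 + 1) d x + 1 / 2 * solid n d x) * hI

theorem isHomogPoly_of_eval {d : ℕ} (L : ℂ →ₗ[ℝ] Cl3) (P : MvPolynomial (Fin 3) ℂ)
    (hP : P.IsHomogeneous d) : IsHomogPoly d fun x => L (P.eval fun i => (x i : ℂ)) := by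
  classical
  refine ⟨fun α => L (P.coeff (Finsupp.equivFunOnFinite.symm α)), fun x => ?_⟩
  beta_reduce
  rw [MvPolynomial.eval_eq', map_sum]
  have hinj : Set.InjOn (fun s : Fin 3 →₀ ℕ => (s : Fin 3 → ℕ)) P.support :=
    DFunLike.coe_injective.injOn
  have hsub : P.support.image (fun s : Fin 3 →₀ ℕ => (s : Fin 3 → ℕ)) ⊆
      Finset.piAntidiag Finset.univ d := by
    intro α hα
    obtain ⟨s, hs, rfl⟩ := Finset.mem_image.1 hα
    have h := hP (MvPolynomial.mem_support_iff.1 hs)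
    rw [Finset.mem_piAntidiag]
    refine ⟨?_, fun _ _ => Finset.mem_univ _⟩
    rw [← h, Finsupp.weight_apply, Finsupp.sum_fintype _ _ (by simp)]
    simp
  rw [← Finset.sum_subset hsub, Finset.sum_image hinj]
  · refine Finset.sum_congr rfl fun s _ => ?_
    rw [← map_smul]
    congr 1
    simp [mul_comm]
  · intro α _ hα
    have : P.coeff (Finsupp.equivFunOnFinite.symm α) = 0 := by
      by_contra h0
      exact hα (Finset.mem_image.2 ⟨_, MvPolynomial.mem_support_iff.2 h0, rfl⟩)
    rw [this, map_zero, smul_zero]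

theorem IsHomogPoly.sub {d : ℕ} {f g : E3 → Cl3} (hf : IsHomogPoly d f) (hg : IsHomogPoly d g) :
    IsHomogPoly d fun x => f x - g x := by
  obtain ⟨c, hc⟩ := hf
  obtain ⟨c', hc'⟩ := hg
  exact ⟨fun α => c α - c' α, fun x => by
    simp only [hc, hc', smul_sub, Finset.sum_sub_distrib]⟩

theorem isHomogPoly_solidMonogenic (n d : ℕ) : IsHomogPoly d (solidMonogenic n d) := by
  obtain ⟨P, hP, hPe⟩ := exists_solid_eq_eval n d
  obtain ⟨Q, hQ, hQe⟩ := exists_solid_eq_eval (n + 1) d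
  have h := (isHomogPoly_of_eval (mulCplxL (e 2)).toLinearMap P hP).sub
    (isHomogPoly_of_eval ((mulCplxL (e 0)).toLinearMap.comp (LinearMap.mulLeft ℝ (1 / 2 : ℂ))) Q hQ)
  convert h using 1
  funext x
  rw [solidMonogenic, hPe, hQe]
  rfl

theorem solidMonogenic_mem (n d : ℕ) : solidMonogenic n d ∈ monogenics d :=
  ⟨isHomogPoly_solidMonogenic n d, (contDiff_solidMonogenic n d).of_le le_top,
    dirac_solidMonogenic n d⟩

/-- The first group of terms has weight `e^(i(n-m)α)` under rotation about the third axis, the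
second `e^(-i(n+m+1)α)`; only `n = m` in the first group is invariant. -/
theorem star_solidMonogenic_mul (n m d : ℕ) (x : E3) :
    star (solidMonogenic n d x) * solidMonogenic m d x =
      cplx (starRingEnd ℂ (solid n d x) * solid m d x +
        1 / 4 * (starRingEnd ℂ (solid (n + 1) d x) * solid (m + 1) d x)) +
      e 0 * e 2 * cplx (1 / 2 * (solid (n + 1) d x * solid m d x -
        solid n d x * solid (m + 1) d x)) := by
  have key : ∀ A B A' B' : ℂ,
      star (e 2 * cplx A - e 0 * cplx B) * (e 2 * cplx A' - e 0 * cplx B') =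
        cplx (starRingEnd ℂ A * A' + starRingEnd ℂ B * B') +
          e 0 * e 2 * cplx (B * A' - A * B') := by
    intro A B A' B'
    have h20 : e 2 * e 0 = -(e 0 * e 2) := e_anticomm (by decide)
    have h1 : cplx (starRingEnd ℂ A) * e 2 * (e 2 * cplx A') =
        -(cplx (starRingEnd ℂ A) * cplx A') := by
      rw [mul_assoc, ← mul_assoc (e 2), e_sq]
      noncomm_ring
    have h2 : cplx (starRingEnd ℂ B) * e 0 * (e 0 * cplx B') =
        -(cplx (starRingEnd ℂ B) * cplx B') := by
      rw [mul_assoc, ← mul_assoc (e 0), e_sq]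
      noncomm_ring
    have h3 : cplx (starRingEnd ℂ A) * e 2 * (e 0 * cplx B') =
        -(e 0 * e 2 * (cplx A * cplx B')) := by
      rw [cplx_mul_e_two, mul_assoc, ← mul_assoc (cplx _), cplx_mul_e_zero, Complex.conj_conj,
        ← mul_assoc, ← mul_assoc, h20]
      noncomm_ring
    have h4 : cplx (starRingEnd ℂ B) * e 0 * (e 2 * cplx A') =
        e 0 * e 2 * (cplx B * cplx A') := by
      rw [cplx_mul_e_zero, Complex.conj_conj, mul_assoc, ← mul_assoc (cplx _), cplx_mul_e_two]
      noncomm_ring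
    rw [star_sub, star_mul, star_mul, star_cplx, star_cplx, star_e, star_e, mul_neg, mul_neg,
      sub_neg_eq_add, add_mul, mul_sub, mul_sub, neg_mul, neg_mul, h1, h2, h3, h4, map_add,
      map_sub, map_mul, map_mul, map_mul, map_mul]
    noncomm_ring
  rw [solidMonogenic, solidMonogenic, key]
  congr 2
  · simp [map_ofNat]
    ring
  · congr 1
    ring

/-! ### Jacobi polynomials and the functions `H_k^j` -/

/-- Vandermonde's identity for `(s + t + n).choose t`, split as `s + (t + n)`, with the factorials
of the other binomial distributed. -/
theorem sum_inv_factorial_eq_choose (n s t : ℕ) :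
    ∑ j ∈ Finset.range (s + t + 1), (if j ≤ s ∧ j ≤ t then
      ((j.factorial : ℝ) * (n + j).factorial * (s - j).factorial * (t - j).factorial)⁻¹ else 0) =
    ((s + t + n).choose t : ℝ) * (s + t + n).choose s / (s + t + n).factorial := by
  have h1 : ((s + t + n).choose s : ℝ) =
      (s + t + n).factorial / (s.factorial * (t + n).factorial) := by
    rw [Nat.cast_choose ℝ (by omega), show s + t + n - s = t + n by omega]
  have h2 : ((s + t + n).choose t : ℝ) =
      ∑ j ∈ Finset.range (t + 1), (s.choose j : ℝ) * (t + n).choose (t - j) := by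
    rw [add_assoc, Nat.add_choose_eq, Finset.Nat.sum_antidiagonal_eq_sum_range_succ_mk]
    push_cast
    rfl
  have h0 (a : ℕ) : (a.factorial : ℝ) ≠ 0 := by exact_mod_cast a.factorial_ne_zero
  rw [h1, h2, Finset.sum_mul, Finset.sum_div]
  symm
  have hsub : Finset.range (t + 1) ⊆ Finset.range (s + t + 1) :=
    Finset.range_subset_range.2 (by omega)
  refine Finset.sum_subset_zero_on_sdiff hsub (fun j hj => ?_) fun j hj => ?_
  · rw [if_neg]
    simp at hj
    omega
  · have hjt : j ≤ t := by simpa [Nat.lt_succ_iff] using hj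
    by_cases hjs : j ≤ s
    · rw [if_pos ⟨hjs, hjt⟩, Nat.cast_choose ℝ hjs, Nat.cast_choose ℝ (by omega : t - j ≤ t + n),
        show t + n - (t - j) = n + j by omega]
      have := h0 s
      have := h0 (t + n)
      have := h0 (s + t + n)
      have := h0 j
      have := h0 (n + j)
      have := h0 (s - j)
      have := h0 (t - j)
      field_simp
    · rw [if_neg (fun h => hjs h.1), Nat.choose_eq_zero_of_lt (by omega)]
      simp

theorem divPow_add_sum (A B : ℝ) (j m : ℕ) (h : 2 * j ≤ m) :
    (A * B) ^ j * ((A + B) ^ (m - 2 * j) / (m - 2 * j).factorial) =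
      ∑ s ∈ Finset.range (m + 1), if j ≤ s ∧ j ≤ m - s then
        ((s - j).factorial * (m - s - j).factorial : ℝ)⁻¹ * (B ^ s * A ^ (m - s)) else 0 := by
  have h0 (a : ℕ) : (a.factorial : ℝ) ≠ 0 := by exact_mod_cast a.factorial_ne_zero
  rw [add_comm A B, add_pow, Finset.sum_div, Finset.mul_sum, ← Finset.sum_filter]
  refine Finset.sum_nbij' (· + j) (· - j) ?_ ?_ ?_ ?_ ?_
  · intro i hi
    simp at hi ⊢
    omega
  · intro i hi
    simp at hi ⊢
    omega
  · intro i hi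
    simp
  · intro i hi
    simp at hi ⊢
    omega
  · intro i hi
    have hi' : i ≤ m - 2 * j := by simpa [Nat.lt_succ_iff] using hi
    rw [Nat.cast_choose ℝ hi', show m - (i + j) = j + (m - 2 * j - i) by omega,
      Nat.add_sub_cancel_left, Nat.add_sub_cancel, pow_add A, pow_add B, mul_pow]
    have := h0 i
    have := h0 (m - 2 * j)
    have := h0 (m - 2 * j - i)
    field_simp

/-- Expanding each `(A + B) ^ (m - 2 * j)` and comparing coefficients of `B ^ s * A ^ (m - s)`
reduces this to `sum_inv_factorial_eq_choose`. -/
theorem sum_choose_mul_choose (n m : ℕ) (A B : ℝ) :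
    ∑ s ∈ Finset.range (m + 1),
      ((m + n).choose (m - s) : ℝ) * ((m + n).choose s : ℝ) * B ^ s * A ^ (m - s) =
    (m + n).factorial * ∑ j ∈ Finset.range (m + 1), if 2 * j ≤ m then
      ((j.factorial : ℝ) * (n + j).factorial)⁻¹ *
        ((A * B) ^ j * ((A + B) ^ (m - 2 * j) / (m - 2 * j).factorial)) else 0 := by
  have h0 (a : ℕ) : (a.factorial : ℝ) ≠ 0 := by exact_mod_cast a.factorial_ne_zero
  have h1 : ∀ j ∈ Finset.range (m + 1), (if 2 * j ≤ m then
      ((j.factorial : ℝ) * (n + j).factorial)⁻¹ *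
        ((A * B) ^ j * ((A + B) ^ (m - 2 * j) / (m - 2 * j).factorial)) else 0) =
      ∑ s ∈ Finset.range (m + 1), (if j ≤ s ∧ j ≤ m - s then
      ((j.factorial : ℝ) * (n + j).factorial * (s - j).factorial * (m - s - j).factorial)⁻¹
        else 0) * (B ^ s * A ^ (m - s)) := by
    intro j _
    split_ifs with h
    · rw [divPow_add_sum A B j m h, Finset.mul_sum]
      refine Finset.sum_congr rfl fun s _ => ?_
      split_ifs
      · rw [← mul_assoc, ← mul_inv]
        ring_nf
      · ring
    · symm
      refine Finset.sum_eq_zero fun s hs => ?_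
      rw [if_neg, zero_mul]
      have := Finset.mem_range.1 hs
      omega
  rw [Finset.sum_congr rfl h1, Finset.sum_comm, Finset.mul_sum]
  refine Finset.sum_congr rfl fun s hs => ?_
  obtain ⟨t, rfl⟩ := Nat.exists_eq_add_of_le (Nat.lt_succ_iff.1 (Finset.mem_range.1 hs))
  rw [Nat.add_sub_cancel_left, ← Finset.sum_mul, sum_inv_factorial_eq_choose]
  have := h0 (s + t + n)
  field_simp

/-- Take `A = (z + r) / 2` and `B = (z - r) / 2`: then `A + B = z` and `A * B = (z² - r²) / 4`,
which is `-ζζ̄ / 4` when `r = ‖x‖`. -/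
theorem pow_mul_jacobiP_div (m n : ℕ) (z r : ℝ) (hr : r ≠ 0) :
    r ^ m * jacobiP m n n (z / r) = (m + n).factorial *
      ∑ j ∈ Finset.range (m + 1), if 2 * j ≤ m then
        ((j.factorial : ℝ) * (n + j).factorial)⁻¹ *
          (((z ^ 2 - r ^ 2) / 4) ^ j * (z ^ (m - 2 * j) / (m - 2 * j).factorial)) else 0 := by
  have h := sum_choose_mul_choose n m ((z + r) / 2) ((z - r) / 2)
  rw [show (z + r) / 2 * ((z - r) / 2) = (z ^ 2 - r ^ 2) / 4 by ring,
    show (z + r) / 2 + (z - r) / 2 = z by ring] at h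
  rw [← h, jacobiP, Finset.mul_sum, Finset.mul_sum]
  refine Finset.sum_congr rfl fun s hs => ?_
  obtain ⟨t, rfl⟩ := Nat.exists_eq_add_of_le (Nat.lt_succ_iff.1 (Finset.mem_range.1 hs))
  rw [Nat.add_sub_cancel_left, show (z - r) / 2 = r * 2⁻¹ * (z / r - 1) by field_simp,
    show (z + r) / 2 = r * 2⁻¹ * (z / r + 1) by field_simp, mul_pow, mul_pow, mul_pow, mul_pow,
    pow_add r, pow_add (2 : ℝ)⁻¹]
  ring

theorem norm_sq_E3 (x : E3) : ‖x‖ ^ 2 = x 0 ^ 2 + x 1 ^ 2 + x 2 ^ 2 := by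
  rw [EuclideanSpace.norm_sq_eq, Fin.sum_univ_three]
  simp

theorem cos_polar (x : E3) : Real.cos (polar x) = x 2 / ‖x‖ := by
  have h : |x 2 / ‖x‖| ≤ 1 := by
    rw [abs_div, abs_norm]
    exact div_le_one_of_le₀ (PiLp.norm_apply_le x 2) (norm_nonneg x)
  exact Real.cos_arccos (abs_le.1 h).1 (abs_le.1 h).2

theorem norm_mul_sin_polar {x : E3} (hx : x ≠ 0) :
    ‖x‖ * Real.sin (polar x) = ‖(⟨x 0, x 1⟩ : ℂ)‖ := by
  have hr : 0 < ‖x‖ := norm_pos_iff.2 hx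
  rw [polar, Real.sin_arccos, Complex.norm_def, Complex.normSq_mk]
  nth_rw 1 [← Real.sqrt_sq hr.le]
  rw [← Real.sqrt_mul (sq_nonneg _)]
  congr 1
  have := norm_sq_E3 x
  field_simp
  linarith

theorem norm_mul_sin_polar_mul_exp {x : E3} (hx : x ≠ 0) (n : ℕ) :
    ((‖x‖ * Real.sin (polar x) : ℝ) : ℂ) ^ n *
      ((Real.cos (n * azimuth x) : ℝ) - Complex.I * (Real.sin (n * azimuth x) : ℝ)) =
      zetaBarL x ^ n := by
  have h1 : (((Real.cos (n * azimuth x) : ℝ) : ℂ) - Complex.I * (Real.sin (n * azimuth x) : ℝ)) =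
      ((Real.cos (azimuth x) : ℝ) - Complex.I * (Real.sin (azimuth x) : ℝ)) ^ n := by
    -- De Moivre at the negative angle, because `ζ̄` has argument `-θ`.
    have := Complex.cos_add_sin_mul_I_pow n (-(azimuth x : ℂ))
    simp only [mul_neg, Complex.cos_neg, Complex.sin_neg] at this
    push_cast
    rw [sub_eq_add_neg, sub_eq_add_neg, mul_comm Complex.I, mul_comm Complex.I, ← neg_mul,
      ← neg_mul, this]
  rw [h1, ← mul_pow, norm_mul_sin_polar hx, zetaBarL_apply]
  have hc := Complex.norm_mul_cos_arg ⟨x 0, x 1⟩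
  have hs := Complex.norm_mul_sin_arg ⟨x 0, x 1⟩
  rw [← azimuth] at hc hs
  have hc' := congrArg Complex.ofReal hc
  have hs' := congrArg Complex.ofReal hs
  rw [Complex.ofReal_mul] at hc' hs'
  congr 1
  linear_combination hc' - Complex.I * hs'

theorem solid_eq_mul_jacobiP (n m : ℕ) {x : E3} (hx : x ≠ 0) :
    ((m + n).factorial : ℂ) * solid n (n + m) x =
      zetaBarL x ^ n * ((‖x‖ ^ m * jacobiP m n n (x 2 / ‖x‖) : ℝ) : ℂ) := by
  rw [pow_mul_jacobiP_div m n _ _ (norm_ne_zero_iff.2 hx), norm_sq_E3]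
  have hu : ∀ j : ℕ, (-1 / 4 : ℂ) ^ j * zetaL x ^ j * zetaBarL x ^ j =
      (((x 2 ^ 2 - (x 0 ^ 2 + x 1 ^ 2 + x 2 ^ 2)) / 4 : ℝ) : ℂ) ^ j := by
    intro j
    rw [← mul_pow, ← mul_pow, zetaL_apply, zetaBarL_apply]
    congr 1
    push_cast
    linear_combination (1 / 4 * x 1 ^ 2) * Complex.I_sq
  push_cast at hu ⊢
  rw [mul_left_comm]
  congr 1
  rw [Finset.mul_sum, solid, show n + m + 1 = m + 1 + n by ring, Finset.sum_range_add,
    Finset.sum_eq_zero (s := Finset.range n), add_zero]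
  · refine Finset.sum_congr rfl fun j _ => ?_
    by_cases h : 2 * j ≤ m
    · rw [if_pos h, if_pos (by omega), Nat.add_sub_cancel_left]
      push_cast
      rw [← hu]
      simp only [divPow, heightL_apply, pow_add, mul_inv]
      ring
    · rw [if_neg h, if_neg (by omega)]
      simp
  · intro j _
    rw [if_neg (by omega)]

/-- The constant relating `H_k^{2n} - i H_k^{2n+1}` to `solid n k`. -/
def harmonicConst (k n : ℕ) : ℝ :=
  k.factorial / (if n = 0 then √(8 * Real.pi) else 2 ^ (n + 1) * √Real.pi)

theorem harmonicConst_ne_zero (k n : ℕ) : harmonicConst k n ≠ 0 := by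
  have := k.factorial_ne_zero
  have := Real.pi_pos
  unfold harmonicConst
  split_ifs <;> positivity

theorem harmonic_eq_solid {k n : ℕ} (hk : 1 ≤ k) (hn : n ≤ k) (x : E3) :
    (harmonic k (2 * n) x : ℂ) - Complex.I * harmonic k (2 * n + 1) x =
      harmonicConst k n * solid n k x := by
  -- The angles mean nothing at the origin, but both sides vanish there since `k ≥ 1`.
  by_cases hx : x = 0
  · subst hx
    have h0 : solid n k 0 = 0 := by
      have := solid_smul n k 0 0
      rwa [zero_smul, Complex.ofReal_zero, zero_pow (by omega), zero_mul] at this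
    have hz : (0 : ℝ) ^ k = 0 := zero_pow (by omega)
    simp [harmonic, h0, hz]
  · have hodd : (2 * n + 1) / 2 = n := by omega
    have heven : (2 * n) / 2 = n := by omega
    obtain ⟨m, rfl⟩ := Nat.exists_eq_add_of_le hn
    have hs := solid_eq_mul_jacobiP n m hx
    rw [← norm_mul_sin_polar_mul_exp hx n, ← cos_polar] at hs
    rcases Nat.eq_zero_or_pos n with rfl | hpos
    · simp only [harmonic, harmonicConst]
      simp at hs ⊢
      rw [div_mul_eq_mul_div, div_mul_eq_mul_div, hs]
    · have hn0 : n ≠ 0 := by omega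
      have h1 : harmonic (n + m) (2 * n) x = ‖x‖ ^ (n + m) / (2 ^ (n + 1) * √Real.pi) *
          Real.sin (polar x) ^ n * jacobiP m n n (Real.cos (polar x)) *
          Real.cos (n * azimuth x) := by
        simp only [harmonic, heven, Nat.add_sub_cancel_left]
        rw [if_neg (by omega), if_pos (even_two_mul n)]
      have h2 : harmonic (n + m) (2 * n + 1) x = ‖x‖ ^ (n + m) / (2 ^ (n + 1) * √Real.pi) *
          Real.sin (polar x) ^ n * jacobiP m n n (Real.cos (polar x)) *
          Real.sin (n * azimuth x) := by
        simp only [harmonic, hodd, Nat.add_sub_cancel_left]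
        rw [if_neg (by omega), if_neg (by simp)]
      rw [h1, h2, harmonicConst, if_neg hn0]
      rw [add_comm m n] at hs
      push_cast at hs ⊢
      linear_combination (-((2 ^ (n + 1) * (√Real.pi : ℂ))⁻¹)) * hs

theorem dirac_mul_right {f : E3 → Cl3} {x : E3} (hf : DifferentiableAt ℝ f x) (a : Cl3) :
    dirac (fun y => f y * a) x = dirac f x * a := by
  have h : fderiv ℝ (fun y => f y * a) x = (mulRightL a).comp (fderiv ℝ f x) :=
    ((mulRightL a).hasFDerivAt.comp x hf.hasFDerivAt).fderiv
  have h3 : ∀ y, mulRightL a y = y * a := fun y => rfl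
  simp only [dirac, h, ContinuousLinearMap.comp_apply, h3, ← mul_assoc, ← Finset.sum_mul]

theorem monogenicF_eq {d n : ℕ} (hn : n ≤ d) :
    monogenicF (d + 1) n = harmonicConst (d + 1) n • solidMonogenic n d := by
  funext x
  set c := harmonicConst (d + 1) n
  set g : E3 → ℂ := fun y => c * solid n (d + 1) y
  have hH (y : E3) : g y = _ :=
    (harmonic_eq_solid (k := d + 1) (n := n) (by omega) (by omega) y).symm
  -- The angular formulas hide smoothness; as real and (negated) imaginary parts of the polynomial
  -- `g`, the harmonics are visibly differentiable.
  have hre : (fun y => algebraMap ℝ Cl3 (harmonic (d + 1) (2 * n) y)) =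
      fun y => 1 * cplx ((g y).re : ℂ) := by
    funext y
    rw [one_mul, cplx_ofReal, hH y]
    simp
  have him : (fun y => algebraMap ℝ Cl3 (harmonic (d + 1) (2 * n + 1) y)) =
      fun y => -1 * cplx ((g y).im : ℂ) := by
    funext y
    rw [cplx_ofReal, hH y]
    simp
  have hgd := (hasFDerivAt_solid n d x).const_mul (c : ℂ)
  have h1 : DifferentiableAt ℝ (fun y => 1 * cplx ((g y).re : ℂ)) x :=
    (hasFDerivAt_mul_cplx 1 ((Complex.ofRealCLM.comp Complex.reCLM).hasFDerivAt.comp x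
      hgd)).differentiableAt
  have h2 : DifferentiableAt ℝ (fun y => -1 * cplx ((g y).im : ℂ)) x :=
    (hasFDerivAt_mul_cplx (-1) ((Complex.ofRealCLM.comp Complex.imCLM).hasFDerivAt.comp x
      hgd)).differentiableAt
  have h2' : DifferentiableAt ℝ (fun y => -1 * cplx ((g y).im : ℂ) * (e 0 * e 1)) x :=
    (mulRightL (e 0 * e 1)).differentiableAt.comp x h2
  rw [monogenicF, diracHarmonic, diracHarmonic, hre, him, ← dirac_mul_right h2, ← dirac_sub h1 h2',
    Pi.smul_apply, ← dirac_cplx_solid]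
  congr 1
  funext y
  rw [one_mul, cplx_ofReal, cplx_ofReal, neg_one_mul, neg_mul, sub_neg_eq_add, ← Algebra.smul_def,
    ← cplx_apply]

/-! ### Integration over the sphere -/

/-- The rotation by the angle `α` about the third axis. -/
def rotation (α : ℝ) : E3 ≃ₗᵢ[ℝ] E3 :=
  LinearIsometry.toLinearIsometryEquiv
    { toFun := fun x => !₂[Real.cos α * x 0 - Real.sin α * x 1,
        Real.sin α * x 0 + Real.cos α * x 1, x 2]
      map_add' := fun x y => by
        ext i
        fin_cases i <;> simp <;> ring
      map_smul' := fun c x => by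
        ext i
        fin_cases i <;> simp <;> ring
      norm_map' := fun x => by
        rw [← sq_eq_sq₀ (norm_nonneg _) (norm_nonneg _), norm_sq_E3, norm_sq_E3]
        simp
        linear_combination (x 0 ^ 2 + x 1 ^ 2) * Real.sin_sq_add_cos_sq α } rfl

theorem rotation_apply (α : ℝ) (x : E3) : rotation α x =
    !₂[Real.cos α * x 0 - Real.sin α * x 1, Real.sin α * x 0 + Real.cos α * x 1, x 2] := rfl

theorem zetaL_rotation (α : ℝ) (x : E3) :
    zetaL (rotation α x) = Complex.exp (α * Complex.I) * zetaL x := by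
  rw [Complex.exp_mul_I, zetaL_apply, zetaL_apply, rotation_apply]
  simp
  linear_combination (-(Complex.sin α * x 1)) * Complex.I_sq

theorem solid_rotation (n d : ℕ) (α : ℝ) (x : E3) :
    solid n d (rotation α x) = Complex.exp (-(n * α * Complex.I)) * solid n d x := by
  rw [solid_rotate n d x _ _ (Complex.norm_exp_ofReal_mul_I α) (zetaL_rotation α x)
    (by simp [rotation_apply]), ← Complex.exp_conj, ← Complex.exp_nat_mul]
  congr 2
  simp
  ring

/-- The spherical measure of a set is a constant times the volume of the cone over it, and a linear
isometry carries cones to cones. -/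
theorem measurePreserving_sphere_isometry {E : Type*} [NormedAddCommGroup E] [NormedSpace ℝ E]
    [MeasurableSpace E] [BorelSpace E] [FiniteDimensional ℝ E] (μ : Measure E)
    (f : E ≃ₗᵢ[ℝ] E) (hf : MeasurePreserving f μ μ) :
    MeasurePreserving (fun x : Metric.sphere (0 : E) 1 =>
      (⟨f x, by simp⟩ : Metric.sphere (0 : E) 1)) μ.toSphere μ.toSphere := by
  have hcont : Continuous (fun x : Metric.sphere (0 : E) 1 =>
      (⟨f x, by simp⟩ : Metric.sphere (0 : E) 1)) :=
    (f.continuous.comp continuous_subtype_val).subtype_mk _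
  refine ⟨hcont.measurable, Measure.ext fun s hs => ?_⟩
  rw [Measure.map_apply hcont.measurable hs, Measure.toSphere_apply' _ (hcont.measurable hs),
    Measure.toSphere_apply' _ hs]
  congr 1
  have hf' : MeasurePreserving f.toHomeomorph.toMeasurableEquiv μ μ := hf
  refine Eq.trans (congrArg μ ?_) (hf'.measure_preimage_equiv _)
  change _ = f ⁻¹' _
  ext y
  simp only [Set.mem_smul, Set.mem_image, Set.mem_preimage, Subtype.exists]
  constructor
  · rintro ⟨t, ht, _, ⟨x, hx, hxs, rfl⟩, rfl⟩
    exact ⟨t, ht, f x, ⟨f x, by simpa using hx, hxs, rfl⟩, (map_smul f t x).symm⟩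
  · rintro ⟨t, ht, _, ⟨x, hx, hxs, rfl⟩, hy⟩
    refine ⟨t, ht, f.symm x, ⟨f.symm x, by simpa using hx, by simpa using hxs, rfl⟩, ?_⟩
    rw [← map_smul, hy]
    exact f.symm_apply_apply y

/-- Rotation invariance of the measure gives `I = c * I` for the integral `I`. -/
theorem integral_eq_zero_of_rotation {g : E3 → ℂ} (hg : Continuous g) (α : ℝ) (c : ℂ) (hc : c ≠ 1)
    (h : ∀ x, g (rotation α x) = c * g x) :
    ∫ ω : Metric.sphere (0 : E3) 1, g ω ∂surfaceMeasure = 0 := by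
  have hmp := measurePreserving_sphere_isometry volume (rotation α)
    (rotation α).measurePreserving
  have h1 := integral_map (μ := surfaceMeasure) hmp.aemeasurable
    (f := fun ω : Metric.sphere (0 : E3) 1 => g ω)
    (hg.comp continuous_subtype_val).aestronglyMeasurable
  rw [hmp.map_eq] at h1
  simp only [h, integral_const_mul] at h1
  have h2 : (1 - c) * ∫ ω : Metric.sphere (0 : E3) 1, g ω ∂surfaceMeasure = 0 := by
    linear_combination h1
  exact (mul_eq_zero.1 h2).resolve_left (sub_ne_zero.2 hc.symm)

theorem continuous_solid (n d : ℕ) : Continuous (solid n d) := (contDiff_solid n d).continuous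

theorem continuous_conj_solid_mul (n m d : ℕ) :
    Continuous fun x => starRingEnd ℂ (solid n d x) * solid m d x :=
  (Complex.continuous_conj.comp (continuous_solid n d)).mul (continuous_solid m d)

theorem integral_conj_solid_mul {n m : ℕ} (h : n ≠ m) (d : ℕ) :
    ∫ ω : Metric.sphere (0 : E3) 1,
      starRingEnd ℂ (solid n d ω) * solid m d ω ∂surfaceMeasure = 0 := by
  -- The angle makes the weight `e^(i(n-m)α)` equal to `e^(iπ) = -1`.
  refine integral_eq_zero_of_rotation (continuous_conj_solid_mul n m d)
    (Real.pi / (n - m : ℝ)) (-1) (by norm_num) fun x => ?_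
  have hnm : (n : ℂ) - m ≠ 0 := sub_ne_zero.2 (by exact_mod_cast h)
  rw [solid_rotation, solid_rotation, map_mul, ← Complex.exp_conj, ← Complex.exp_pi_mul_I,
    mul_mul_mul_comm, ← Complex.exp_add]
  congr 2
  simp
  field_simp
  ring

theorem integral_solid_mul {n m : ℕ} (h : n + m ≠ 0) (d : ℕ) :
    ∫ ω : Metric.sphere (0 : E3) 1, solid n d ω * solid m d ω ∂surfaceMeasure = 0 := by
  refine integral_eq_zero_of_rotation ((continuous_solid n d).mul (continuous_solid m d))
    (-Real.pi / (n + m : ℝ)) (-1) (by norm_num) fun x => ?_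
  simp only [Pi.mul_apply]
  have hnm : (n : ℂ) + m ≠ 0 := by exact_mod_cast h
  rw [solid_rotation, solid_rotation, ← Complex.exp_pi_mul_I,
    mul_mul_mul_comm, ← Complex.exp_add]
  congr 2
  simp
  field_simp

theorem integrable_of_continuous {F : Type*} [NormedAddCommGroup F] {g : E3 → F}
    (hg : Continuous g) :
    Integrable (fun ω : Metric.sphere (0 : E3) 1 => g ω) surfaceMeasure :=
  (hg.comp continuous_subtype_val).integrable_of_hasCompactSupport
    (HasCompactSupport.of_compactSpace _)

theorem continuous_star_solidMonogenic_mul (n m d : ℕ) :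
    Continuous fun x => star (solidMonogenic n d x) * solidMonogenic m d x := by
  simp only [star_solidMonogenic_mul]
  refine Continuous.add ?_ ((mulCplxL (e 0 * e 2)).continuous.comp ?_)
  · have : Continuous cplx := cplx.toLinearMap.continuous_of_finiteDimensional
    exact this.comp ((continuous_conj_solid_mul n m d).add
      (continuous_const.mul (continuous_conj_solid_mul (n + 1) (m + 1) d)))
  · exact continuous_const.mul (((continuous_solid (n + 1) d).mul (continuous_solid m d)).sub
      ((continuous_solid n d).mul (continuous_solid (m + 1) d)))

theorem integral_star_solidMonogenic_mul {n m : ℕ} (h : n ≠ m) (d : ℕ) :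
    ∫ ω : Metric.sphere (0 : E3) 1,
      star (solidMonogenic n d ω) * solidMonogenic m d ω ∂surfaceMeasure = 0 := by
  have : CompleteSpace Cl3 := FiniteDimensional.complete ℝ Cl3
  have i1 := integrable_of_continuous (continuous_conj_solid_mul n m d)
  have i2 := integrable_of_continuous (continuous_conj_solid_mul (n + 1) (m + 1) d)
  have i3 := integrable_of_continuous ((continuous_solid (n + 1) d).mul (continuous_solid m d))
  have i4 := integrable_of_continuous ((continuous_solid n d).mul (continuous_solid (m + 1) d))
  have h1 := (mulCplxL 1).integral_comp_comm (i1.add (i2.const_mul (1 / 4)))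
  have h2 := (mulCplxL (e 0 * e 2)).integral_comp_comm ((i3.sub i4).const_mul (1 / 2))
  have j1 := (mulCplxL 1).integrable_comp (i1.add (i2.const_mul (1 / 4)))
  have j2 := (mulCplxL (e 0 * e 2)).integrable_comp ((i3.sub i4).const_mul (1 / 2))
  simp only [star_solidMonogenic_mul]
  have h3 := integral_add j1 j2
  rw [h1, h2] at h3
  simp only [mulCplxL_apply, one_mul, Pi.add_apply, Pi.sub_apply, Pi.mul_apply] at h3 i3 i4
  rw [h3, integral_add i1 (i2.const_mul _), integral_const_mul, integral_const_mul,
    integral_sub i3 i4, integral_conj_solid_mul h, integral_conj_solid_mul (by omega),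
    integral_solid_mul (by omega), integral_solid_mul (by omega)]
  simp

/-- On the diagonal the `e 0 * e 2` part cancels by commutativity of `ℂ`, leaving a nonnegative real
function that is not identically zero on the sphere. -/
theorem integral_star_solidMonogenic_mul_self {n d : ℕ} (h : n ≤ d) :
    ∃ r : ℝ, r ≠ 0 ∧ ∫ ω : Metric.sphere (0 : E3) 1,
      star (solidMonogenic n d ω) * solidMonogenic n d ω ∂surfaceMeasure =
        algebraMap ℝ Cl3 r := by
  have : CompleteSpace Cl3 := FiniteDimensional.complete ℝ Cl3
  set g : E3 → ℝ := fun x => ‖solid n d x‖ ^ 2 + 1 / 4 * ‖solid (n + 1) d x‖ ^ 2 with hg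
  have hgc : Continuous g := ((continuous_solid n d).norm.pow 2).add
    (continuous_const.mul ((continuous_solid (n + 1) d).norm.pow 2))
  have hpt (x : E3) : star (solidMonogenic n d x) * solidMonogenic n d x =
      LinearMap.toContinuousLinearMap (Algebra.linearMap ℝ Cl3) (g x) := by
    rw [star_solidMonogenic_mul, mul_comm (solid (n + 1) d x), sub_self, mul_zero, map_zero,
      mul_zero, add_zero, ← Complex.normSq_eq_conj_mul_self, ← Complex.normSq_eq_conj_mul_self,
      Complex.normSq_eq_norm_sq, Complex.normSq_eq_norm_sq]
    exact (congrArg cplx (by simp [hg])).trans (cplx_ofReal (g x))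
  refine ⟨∫ ω : Metric.sphere (0 : E3) 1, g ω ∂surfaceMeasure, ne_of_gt ?_, ?_⟩
  · obtain ⟨ω, hω⟩ := exists_sphere_solid_ne_zero n d h
    refine (hgc.comp continuous_subtype_val).integral_pos_of_hasCompactSupport_nonneg_nonzero
      (HasCompactSupport.of_compactSpace _) (fun x => ?_) (x := ω) ?_
    · simp only [hg, Pi.zero_apply]
      positivity
    · have : 0 < ‖solid n d ω‖ := norm_pos_iff.2 hω
      simp only [hg]
      positivity
  · simp only [hpt]
    rw [ContinuousLinearMap.integral_comp_comm _ (integrable_of_continuous hgc)]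
    rfl

/-- Multiplying on the left by `star (solidMonogenic m d)` and integrating isolates `a m`. It
matters that the diagonal integral is a real scalar: `ℝ₃` has zero divisors. -/
theorem linearIndependent_solidMonogenic {d : ℕ} (a : Fin (d + 1) → Cl3)
    (h : ∀ x, ∑ n : Fin (d + 1), solidMonogenic n d x * a n = 0) : a = 0 := by
  funext m
  obtain ⟨r, hr, hint⟩ := integral_star_solidMonogenic_mul_self (Nat.lt_succ_iff.1 m.2)
  have : CompleteSpace Cl3 := FiniteDimensional.complete ℝ Cl3
  have hi (n : Fin (d + 1)) := integrable_of_continuous (continuous_star_solidMonogenic_mul m n d)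
  have h1 (n : Fin (d + 1)) := (mulRightL (a n)).integral_comp_comm (hi n)
  have j1 (n : Fin (d + 1)) := (mulRightL (a n)).integrable_comp (hi n)
  have h2 : ∫ ω : Metric.sphere (0 : E3) 1, ∑ n : Fin (d + 1), mulRightL (a n)
      (star (solidMonogenic m d ω) * solidMonogenic n d ω) ∂surfaceMeasure = 0 := by
    have hz (x : E3) : ∑ n : Fin (d + 1), mulRightL (a n)
        (star (solidMonogenic m d x) * solidMonogenic n d x) = 0 := by
      have hm : ∀ a y, mulRightL a y = y * a := fun _ _ => rfl
      simp only [hm, mul_assoc]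
      rw [← Finset.mul_sum, h, mul_zero]
    simp only [hz, integral_zero]
  rw [integral_finsetSum _ fun n _ => j1 n, Finset.sum_eq_single m, h1, hint] at h2
  · change algebraMap ℝ Cl3 r * a m = 0 at h2
    rw [← Algebra.smul_def] at h2
    exact (smul_eq_zero.1 h2).resolve_left hr
  · intro n _ hn
    rw [h1, integral_star_solidMonogenic_mul (fun h => hn (Fin.ext h.symm)), map_zero]
  · simp

/-! ### Monogenic functions are determined by their values on the plane `x₃ = 0` -/

theorem eq_zero_of_e_two_mul {a : Cl3} (h : e 2 * a = 0) : a = 0 := by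
  have h1 := congrArg (e 2 * ·) h
  simpa only [← mul_assoc, e_sq, neg_one_mul, mul_zero, neg_eq_zero] using h1

/-- Induction on the degree. On `x₃ = 0` the tangential derivatives of `f` vanish, so `∂ₓf = 0`
forces `∂₃f = 0` there. As `∂₃f` is monogenic and homogeneous of lower degree, it vanishes
everywhere, and `f` is constant on vertical lines, each of which meets the plane. -/
theorem eq_zero_of_dirac_eq_zero (d : ℕ) (f : E3 → Cl3) (hf : ContDiff ℝ ⊤ f)
    (hhom : ∀ t : ℝ, t ≠ 0 → ∀ x, f (t • x) = t ^ d • f x) (hd : ∀ x, dirac f x = 0)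
    (h0 : ∀ x : E3, x 2 = 0 → f x = 0) : f = 0 := by
  induction d generalizing f with
  | zero =>
    funext x
    have h1 : Filter.Tendsto (fun t : ℝ => f (t • x)) (nhdsWithin 0 {0}ᶜ) (nhds (f 0)) := by
      have : Continuous fun t : ℝ => f (t • x) := by
        have := hf.continuous
        fun_prop
      simpa using (this.tendsto 0).mono_left nhdsWithin_le_nhds
    have h2 : Filter.Tendsto (fun t : ℝ => f (t • x)) (nhdsWithin 0 {0}ᶜ) (nhds (f x)) := by
      refine tendsto_const_nhds.congr' ?_
      filter_upwards [self_mem_nhdsWithin] with t ht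
      rw [hhom t ht, pow_zero, one_smul]
    rw [tendsto_nhds_unique h2 h1, h0 0 rfl, Pi.zero_apply]
  | succ d ih =>
    have hdf : Differentiable ℝ f := hf.differentiable (by simp)
    have hf' : ContDiff ℝ ⊤ (fderiv ℝ f) := hf.fderiv_right (by simp)
    have hdf' : Differentiable ℝ (fderiv ℝ f) := hf'.differentiable (by simp)
    have hg : (fun x => fderiv ℝ f x (EuclideanSpace.single 2 1)) = 0 := by
      refine ih _ (hf'.clm_apply contDiff_const) ?_ ?_ ?_
      · intro t ht x
        have h1 := fderiv_comp_smul (𝕜 := ℝ) (f := f) (x := x) t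
        have h2 : (fun y => f (t • y)) = fun y => t ^ (d + 1) • f y := funext (hhom t ht)
        rw [h2, fderiv_fun_const_smul (hdf x)] at h1
        have h3 := congrArg (fun L => t⁻¹ • L (EuclideanSpace.single 2 1)) h1
        simp only [smul_apply, smul_smul, inv_mul_cancel₀ ht, one_smul] at h3
        rw [← h3, pow_succ', inv_mul_cancel_left₀ ht]
      · intro x
        -- Symmetry of second derivatives lets `∂₃` commute with `∂ₓ`.
        have hs : IsSymmSndFDerivAt ℝ f x :=
          hf.contDiffAt.isSymmSndFDerivAt (by simp [minSmoothness_of_isRCLikeNormedField])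
        have h1 (j : Fin 3) : fderiv ℝ (fun x => fderiv ℝ f x (EuclideanSpace.single 2 1)) x
            (EuclideanSpace.single j 1) =
            fderiv ℝ (fun x => fderiv ℝ f x (EuclideanSpace.single j 1)) x
              (EuclideanSpace.single 2 1) := by
          rw [fderiv_clm_apply (hdf' x) (differentiableAt_const _),
            fderiv_clm_apply (hdf' x) (differentiableAt_const _)]
          simpa using hs.eq _ _
        have hL (j : Fin 3) : HasFDerivAt
            (fun x => LinearMap.toContinuousLinearMap (LinearMap.mulLeft ℝ (e j))
              (fderiv ℝ f x (EuclideanSpace.single j 1)))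
            ((LinearMap.toContinuousLinearMap (LinearMap.mulLeft ℝ (e j))).comp
              (fderiv ℝ (fun x => fderiv ℝ f x (EuclideanSpace.single j 1)) x)) x :=
          (ContinuousLinearMap.hasFDerivAt _).comp x
            ((hf'.clm_apply contDiff_const).differentiable (by simp) x).hasFDerivAt
        have h2 := HasFDerivAt.fun_sum (u := Finset.univ) fun j _ => hL j
        have h3 := h2.unique
          ((hasFDerivAt_const (𝕜 := ℝ) (0 : Cl3) x).congr_of_eventuallyEq
            (Filter.Eventually.of_forall hd))
        have h4 := congrArg (fun L => L (EuclideanSpace.single 2 1)) h3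
        simp only [sum_apply] at h4
        simp only [dirac, h1]
        exact h4
      · intro x hx
        have h1 (j : Fin 3) (hj : j ≠ 2) : fderiv ℝ f x (EuclideanSpace.single j 1) = 0 := by
          have h2 : HasLineDerivAt ℝ f (fderiv ℝ f x (EuclideanSpace.single j 1)) x
              (EuclideanSpace.single j 1) := (hdf x).hasFDerivAt.hasLineDerivAt _
          have h3 : (fun t : ℝ => f (x + t • EuclideanSpace.single j 1)) = fun _ => 0 := by
            funext t
            refine h0 _ ?_
            simp [hx, hj.symm]
          rw [HasLineDerivAt, h3] at h2
          exact h2.unique (hasDerivAt_const _ _)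
        have h2 := hd x
        rw [dirac, Fin.sum_univ_three, h1 0 (by decide), h1 1 (by decide), mul_zero, mul_zero,
          zero_add, zero_add] at h2
        exact eq_zero_of_e_two_mul h2
    funext x
    have h1 (t : ℝ) : HasDerivAt (fun t : ℝ => f (x + t • EuclideanSpace.single 2 1)) 0 t := by
      have h2 : HasDerivAt (fun t : ℝ => x + t • (EuclideanSpace.single 2 1 : E3))
          (EuclideanSpace.single 2 1) t := by
        simpa using ((hasDerivAt_id t).smul_const (EuclideanSpace.single 2 1 : E3)).const_add x
      have h3 := (hdf _).hasFDerivAt.comp_hasDerivAt t h2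
      rwa [congrFun hg (x + t • EuclideanSpace.single 2 1)] at h3
    have h2 := is_const_of_deriv_eq_zero (fun t => (h1 t).differentiableAt)
      (fun t => (h1 t).deriv) 0 (-x 2)
    simp only [zero_smul, add_zero] at h2
    rw [h2, Pi.zero_apply]
    exact h0 _ (by simp)

theorem IsHomogPoly.contDiff {d : ℕ} {f : E3 → Cl3} (hf : IsHomogPoly d f) : ContDiff ℝ ⊤ f := by
  obtain ⟨c, hc⟩ := hf
  rw [funext hc]
  fun_prop

theorem IsHomogPoly.map_smul {d : ℕ} {f : E3 → Cl3} (hf : IsHomogPoly d f) (t : ℝ) (x : E3) :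
    f (t • x) = t ^ d • f x := by
  obtain ⟨c, hc⟩ := hf
  rw [hc, hc, Finset.smul_sum]
  refine Finset.sum_congr rfl fun α hα => ?_
  rw [smul_smul, ← (Finset.mem_piAntidiag.1 hα).1, ← Finset.prod_pow_eq_pow_sum,
    ← Finset.prod_mul_distrib]
  simp [mul_pow]

/-- The orthogonal projection onto the plane `x₃ = 0`. -/
def toPlane (x : E3) : E3 := !₂[x 0, x 1, 0]

/-- The homogeneous polynomials of degree `d` in `x₁, x₂` with given coefficients. -/
def planePoly (d : ℕ) : (Fin (d + 1) → Cl3) →ₗ[ℝ] (E3 → Cl3) where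
  toFun c x := ∑ a : Fin (d + 1), (x 0 ^ (a : ℕ) * x 1 ^ (d - a)) • c a
  map_add' c c' := by
    funext x
    simp [Finset.sum_add_distrib]
  map_smul' t c := by
    funext x
    simp [Finset.smul_sum, smul_comm t]

/-- Monomials containing `x₃` vanish on the plane; the others are the `x₁^a x₂^(d-a)`. -/
theorem IsHomogPoly.comp_toPlane_mem {d : ℕ} {f : E3 → Cl3} (hf : IsHomogPoly d f) :
    (fun x => f (toPlane x)) ∈ LinearMap.range (planePoly d) := by
  classical
  obtain ⟨c, hc⟩ := hf
  refine ⟨fun a => c ![a, d - a, 0], funext fun x => ?_⟩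
  rw [hc]
  have hinj : Set.InjOn (fun a : Fin (d + 1) => (![(a : ℕ), d - a, 0] : Fin 3 → ℕ))
      (Finset.univ : Finset (Fin (d + 1))) := fun a _ b _ h => Fin.ext (congrFun h 0)
  have hsub : Finset.univ.image (fun a : Fin (d + 1) => (![(a : ℕ), d - a, 0] : Fin 3 → ℕ)) ⊆
      Finset.piAntidiag Finset.univ d := by
    intro α hα
    obtain ⟨a, _, rfl⟩ := Finset.mem_image.1 hα
    rw [Finset.mem_piAntidiag, Fin.sum_univ_three]
    refine ⟨?_, fun _ _ => Finset.mem_univ _⟩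
    have := a.2
    simp
    omega
  rw [← Finset.sum_subset hsub, Finset.sum_image hinj]
  · simp [planePoly, toPlane, Fin.prod_univ_three]
  · intro α hα hα'
    rw [Finset.mem_piAntidiag, Fin.sum_univ_three] at hα
    have h2 : α 2 ≠ 0 := by
      intro h2
      refine hα' (Finset.mem_image.2 ⟨⟨α 0, by omega⟩, Finset.mem_univ _, ?_⟩)
      funext i
      fin_cases i
      · rfl
      · simp
        omega
      · simp [h2]
    simp [toPlane, Fin.prod_univ_three, h2]

/-- The real vector space underlying `monogenics d`. -/
def realMonogenics (d : ℕ) : Submodule ℝ (E3 → Cl3) := (monogenics d).restrictScalars ℝ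

/-- Restriction to the plane `x₃ = 0`. -/
def planeRestrict (d : ℕ) : realMonogenics d →ₗ[ℝ] LinearMap.range (planePoly d) :=
  ((LinearMap.funLeft ℝ Cl3 toPlane).comp (realMonogenics d).subtype).codRestrict _
    fun f => IsHomogPoly.comp_toPlane_mem f.2.1

theorem planeRestrict_injective (d : ℕ) : Function.Injective (planeRestrict d) := by
  rw [injective_iff_map_eq_zero]
  intro f hf
  refine Subtype.ext (eq_zero_of_dirac_eq_zero d f f.2.1.contDiff
    (fun t _ => f.2.1.map_smul t) f.2.2.2 fun x hx => ?_)
  have h1 := congrFun (congrArg Subtype.val hf) x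
  have h2 : toPlane x = x := by
    ext i
    fin_cases i <;> simp [toPlane, hx]
  change (f : E3 → Cl3) (toPlane x) = 0 at h1
  rwa [h2] at h1

instance (d : ℕ) : FiniteDimensional ℝ (realMonogenics d) :=
  Module.Finite.of_injective _ (planeRestrict_injective d)

theorem finrank_realMonogenics_le (d : ℕ) :
    Module.finrank ℝ (realMonogenics d) ≤ Module.finrank ℝ (Fin (d + 1) → Cl3) :=
  (LinearMap.finrank_le_finrank_of_injective (planeRestrict_injective d)).trans
    (LinearMap.finrank_range_le _)

/-! ### The orthogonal basis -/

theorem star_monogenicF_mul {d n m : ℕ} (hn : n ≤ d) (hm : m ≤ d) (x : E3) :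
    star (monogenicF (d + 1) n x) * monogenicF (d + 1) m x =
      (harmonicConst (d + 1) n * harmonicConst (d + 1) m) •
        (star (solidMonogenic n d x) * solidMonogenic m d x) := by
  rw [monogenicF_eq hn, monogenicF_eq hm, Pi.smul_apply, Pi.smul_apply,
    CliffordAlgebra.star_smul, smul_mul_smul_comm]

theorem monogenicF_mem {d n : ℕ} (hn : n ≤ d) : monogenicF (d + 1) n ∈ monogenics d := by
  rw [monogenicF_eq hn]
  exact (realMonogenics d).smul_mem _ (solidMonogenic_mem n d)

theorem sum_monogenicF_mul_eq_zero {d : ℕ} (a : Fin (d + 1) → Cl3)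
    (h : ∀ x, ∑ n : Fin (d + 1), monogenicF (d + 1) n x * a n = 0) : a = 0 := by
  have h1 := linearIndependent_solidMonogenic
    (fun n : Fin (d + 1) => harmonicConst (d + 1) n • a n) fun x => by
      rw [← h x]
      refine Finset.sum_congr rfl fun n _ => ?_
      rw [monogenicF_eq (Nat.lt_succ_iff.1 n.2), Pi.smul_apply, smul_mul_assoc, mul_smul_comm]
  funext n
  exact (smul_eq_zero.1 (congrFun h1 n)).resolve_left (harmonicConst_ne_zero _ _)

/-- Right linear combinations of the functions `F_d^n`. -/
def combineF (d : ℕ) : (Fin (d + 1) → Cl3) →ₗ[ℝ] realMonogenics d where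
  toFun a := ∑ n : Fin (d + 1), (⟨MulOpposite.op (a n) • monogenicF (d + 1) n,
    (monogenics d).smul_mem _ (monogenicF_mem (Nat.lt_succ_iff.1 n.2))⟩ : realMonogenics d)
  map_add' a b := by
    rw [← Finset.sum_add_distrib]
    refine Finset.sum_congr rfl fun n _ => Subtype.ext ?_
    simp [add_smul]
  map_smul' t a := by
    rw [Finset.smul_sum]
    refine Finset.sum_congr rfl fun n _ => Subtype.ext ?_
    simp

theorem combineF_apply (d : ℕ) (a : Fin (d + 1) → Cl3) (x : E3) :
    (combineF d a : E3 → Cl3) x = ∑ n : Fin (d + 1), monogenicF (d + 1) n x * a n := by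
  simp [combineF]

/-- An injective real-linear map into a space of no larger dimension is onto. -/
theorem combineF_surjective (d : ℕ) : Function.Surjective (combineF d) := by
  have hinj : Function.Injective (combineF d) := by
    rw [injective_iff_map_eq_zero]
    intro a ha
    refine sum_monogenicF_mul_eq_zero a fun x => ?_
    rw [← combineF_apply, ha]
    rfl
  exact (LinearMap.injective_iff_surjective_of_finrank_eq_finrank
    (le_antisymm (LinearMap.finrank_le_finrank_of_injective hinj)
      (finrank_realMonogenics_le d))).1 hinj

/-- The functions `F_d^0, …, F_d^d` as elements of the module of spherical monogenics. -/
def monogenicFamily (d : ℕ) (n : Fin (d + 1)) : monogenics d :=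
  ⟨monogenicF (d + 1) n, monogenicF_mem (Nat.lt_succ_iff.1 n.2)⟩

theorem linearIndependent_monogenicFamily (d : ℕ) :
    LinearIndependent Cl3ᵐᵒᵖ (monogenicFamily d) := by
  rw [Fintype.linearIndependent_iff]
  intro a ha n
  have h1 := sum_monogenicF_mul_eq_zero (fun n => (a n).unop) fun x => by
    have := congrFun (congrArg Subtype.val ha) x
    simpa [monogenicFamily] using this
  exact MulOpposite.unop_injective (congrFun h1 n)

theorem top_le_span_monogenicFamily (d : ℕ) :
    ⊤ ≤ Submodule.span Cl3ᵐᵒᵖ (Set.range (monogenicFamily d)) := by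
  intro f _
  obtain ⟨a, ha⟩ := combineF_surjective d ⟨f, f.2⟩
  have hf : f = ∑ n, MulOpposite.op (a n) • monogenicFamily d n := by
    refine Subtype.ext (funext fun x => ?_)
    have h1 : (combineF d a : E3 → Cl3) x = (f : E3 → Cl3) x := by rw [ha]
    rw [← h1, combineF_apply]
    simp [monogenicFamily]
  rw [hf]
  exact Submodule.sum_mem _ fun n _ =>
    Submodule.smul_mem _ _ (Submodule.subset_span ⟨n, rfl⟩)

end SphMon

end

/-- Integrability is asserted as well because a Bochner integral is zero by convention when the
integrand is not integrable. -/
theorem mainTheorem1 (k : ℕ) (hk : 1 ≤ k) :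
    (∀ n n' : Fin k, n ≠ n' →
      Integrable (fun ω : Metric.sphere (0 : SphMon.E3) 1 =>
        star (SphMon.monogenicF k n ω) * SphMon.monogenicF k n' ω) SphMon.surfaceMeasure ∧
      ∫ ω : Metric.sphere (0 : SphMon.E3) 1,
        star (SphMon.monogenicF k n ω) * SphMon.monogenicF k n' ω ∂SphMon.surfaceMeasure = 0) ∧
    ∃ b : Module.Basis (Fin k) SphMon.Cl3ᵐᵒᵖ (SphMon.monogenics (k - 1)),
      ∀ n : Fin k, (b n : SphMon.E3 → SphMon.Cl3) = SphMon.monogenicF k n := by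
  obtain ⟨d, rfl⟩ := Nat.exists_eq_add_of_le' hk
  refine ⟨fun n n' hnn => ?_, Module.Basis.mk (SphMon.linearIndependent_monogenicFamily d)
    (SphMon.top_le_span_monogenicFamily d), fun n => ?_⟩
  · simp only [SphMon.star_monogenicF_mul (Nat.lt_succ_iff.1 n.2) (Nat.lt_succ_iff.1 n'.2)]
    constructor
    · exact SphMon.integrable_of_continuous
        (g := fun x => _ • (star (SphMon.solidMonogenic n d x) * SphMon.solidMonogenic n' d x))
        ((SphMon.continuous_star_solidMonogenic_mul n n' d).fun_const_smul _)
    · rw [integral_smul, SphMon.integral_star_solidMonogenic_mul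
        (fun h => hnn (Fin.ext h)), smul_zero]
  · exact congrArg Subtype.val (Module.Basis.mk_apply _ _ n)
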